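/- Let $\mathbb K$ be a global field, that is, a finite extension of $\mathbb K_0=\mathbb Q$ or of the function field $\mathbb K_0=K(C)$ of a regular projective curve $C$ over an arbitrary field. Let $\mathfrak M_{\mathbb K}$ be its set of places: the absolute values of $\mathbb K$ that extend the normalized absolute values of the places $v_0$ of $\mathbb K_0$, with weights $n_v=\frac{[\mathbb K_v:\mathbb K_{0,v_0}]}{[\mathbb K:\mathbb K_0]}\,n_{v_0}$, where $n_{v_0}=1$ if $\mathbb K_0=\mathbb Q$ and $n_{v_0}$ is the degree of the closed point $v_0$ of $C$ in the function field case. Let $X$ be a proper toric variety over $\mathbb K$ of dimension $n$, with split torus $\mathbb T$, given by a complete fan on $N_{\mathbb R}\simeq\mathbb R^n$, and put $M_{\mathbb R}=N_{\mathbb R}^\vee$. Let $\overline D$ be a semipositive toric metrized $\mathbb R$-divisor on $X$ with $D$ big. Here the virtual support function $\Psi_D$ describes $D$, bigness means that the polytope $\Delta_D=\{x\in M_{\mathbb R}: \langle x,u\rangle\ge\Psi_D(u)\ \forall u\in N_{\mathbb R}\}$ has nonempty interior, the $v$-adic metrics are continuous and invariant under the compact torus for all $v$, and equal to the canonical metric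 for all but finitely many $v$. Semipositive means that for every $v$ the $v$-adic metric on $D$ is a uniform limit of positive real combinations $D=\sum_i\alpha_iE_i$ of toric Cartier divisors $E_i$ with metrics of Fubini–Study type $\|s_{E_i}(p)\|=(\max_j c_{ij}|f_{ij}(p)|_v)^{-1}$, where $c_{ij}\in\mathbb R_{>0}$ and where, for each $i$, the $f_{ij}s_{E_i}$ are finitely many global sections of $E_i$ without common zeros. Let $\operatorname{val}_v(x_1,\dots,x_n)=(-\log|x_1|_v,\dots,-\log|x_n|_v)$ be the valuation map on the analytification $\mathbb T_v^{\mathrm{an}}$ and $s_D$ the canonical rational section of $D$. Define $\psi_v\colon N_{\mathbb R}\to\mathbb R$ by $\psi_v(\operatorname{val}_v(p))=\log\|s_D(p)\|_v$, the local roof functions $\vartheta_v(x)=\inf_{u\in N_{\mathbb R}}(\langle x,u\rangle-\psi_v(u))$ and the global roof function $\vartheta=\sum_v n_v\vartheta_v$ on $\Delta_D$, and let $\Delta_{D,\max}\subset\Delta_D$ be the set of maximum points of $\vartheta$. For a concave function $g$ on $\Delta_D$, put $\partial g(x)=\{u\in N_{\mathbb R}:\langle u,z-x\rangle\ge g(z)-g(x)\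 \forall z\in\Delta_D\}$. For a place $v$ let $g_{1,v}=\vartheta_v$ and $g_{2,v}=\sum_{w\ne v}\frac{n_w}{n_v}\vartheta_w$, and let $F_v$ be the minimal face of $\partial g_{1,v}(x)$ containing $\partial g_{1,v}(x)\cap(-\partial g_{2,v}(x))$, for any $x\in\Delta_{D,\max}$ (it does not depend on $x$). A vertex of a convex set is a face consisting of one point. Let $\mathcal H_{\mathbb K}$ be the set of families $\boldsymbol\nu=(\nu_v)_{v\in\mathfrak M_{\mathbb K}}$ of Borel probability measures on $N_{\mathbb R}$ with finite first moment, with $\nu_v=\delta_0$ for all but finitely many $v$ and $\sum_v n_v\operatorname{E}[\nu_v]=0$, and put $\eta_{\overline D}(\boldsymbol\nu)=-\sum_v n_v\int\psi_v\,d\nu_v$. Let $H_{\mathbb K}=\{(u_v)_v\in\bigoplus_v N_{\mathbb R}:\sum_v n_vu_v=0\}$, which embeds in $\mathcal H_{\mathbb K}$ by $(u_v)_v\mapsto(\delta_{u_v})_v$. The divisor $\overline D$ is called monocritical if $\eta_{\overline D}$ attains its minimum over $\mathcal H_{\mathbb K}$ at a unique point; if this point comes from an element of $H_{\mathbb K}$,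 that element is called the critical point of $\overline D$. The following conditions are equivalent: 1. $\overline D$ is monocritical; 2. for every $x\in\Delta_{D,\max}$, the set $H_{\mathbb K}\cap\prod_v\partial\vartheta_v(x)$ consists of a unique element $\boldsymbol u=(u_v)_v$, and $u_v$ is a vertex of $\partial\vartheta_v(x)$ for every $v$; 3. for every $x\in\Delta_{D,\max}$, the point $0$ is a vertex of $\partial\vartheta(x)$; 4. there exists $x\in\Delta_{D,\max}$ such that $0$ is a vertex of $\partial\vartheta(x)$; 5. for every $v\in\mathfrak M_{\mathbb K}$, the set $F_v$ consists of one point. When these conditions hold, the element $\boldsymbol u$ in (2) is the same for all $x\in\Delta_{D,\max}$, it is the critical point of $\overline D$ (which exists), and $F_v=\{u_v\}$ for every $v$. -/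

import Mathlib

open MeasureTheory

noncomputable section

namespace ToricHeights

universe u w

/-! ## Global fields and their places -/

/-- The two kinds of base global fields: (a copy of) `ℚ`, and the function field of a regular
projective curve over an arbitrary field `k`, that is, a finitely generated extension of
transcendence degree one of a subfield `k`. -/
inductive BaseField (K₀ : Type u) [Field K₀] : Type u
  | rational (e : K₀ ≃+* ℚ)
  | functionField (k : Subfield K₀) (fg : (⊤ : IntermediateField k K₀).FG)
      (trdeg : Algebra.trdeg k K₀ = 1)

/-- A closed point of the regular projective curve over `k` with function field `F`, given by its
local ring: a discrete valuation ring of `F` that contains `k`, with fraction field `F` and residue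
field finite over `k`. -/
structure ClosedPoint {F : Type u} [Field F] (k : Subfield F) where
  localRing : ValuationSubring F
  constants_mem : ∀ a ∈ k, a ∈ localRing
  isDiscrete : IsDiscreteValuationRing localRing
  residue_finite : ((IsLocalRing.residue localRing).comp
    (k.subtype.codRestrict localRing fun a => constants_mem a a.2)).Finite

namespace ClosedPoint

variable {F : Type u} [Field F] {k : Subfield F}

/-- The map from the constants to the residue field of a closed point. -/
def residueMap (v : ClosedPoint k) : k →+* IsLocalRing.ResidueField v.localRing :=
  (IsLocalRing.residue v.localRing).comp
    (k.subtype.codRestrict v.localRing fun a => v.constants_mem a a.2)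

/-- The degree `[k(v) : k]` of a closed point. -/
def degree (v : ClosedPoint k) : ℕ :=
  letI : Module k (IsLocalRing.ResidueField v.localRing) := v.residueMap.toModule
  Module.finrank k (IsLocalRing.ResidueField v.localRing)

end ClosedPoint

open Classical in
/-- The constant `c_k`: the cardinality of `k` if `k` is finite, and `e` otherwise. -/
def curveConstant {F : Type u} [Field F] (k : Subfield F) : ℝ :=
  if Finite k then (Nat.card k : ℝ) else Real.exp 1

namespace BaseField

variable {K₀ : Type u} [Field K₀]

/-- The places of `ℚ` are `∞` (here `none`) and the prime numbers; the places of a function field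
are the closed points of the curve. -/
def BasePlace : BaseField K₀ → Type u
  | rational _ => ULift (Option Nat.Primes)
  | functionField k _ _ => ClosedPoint k

/-- `w` is the normalized absolute value on `K₀` at a place: the usual and the `p`-adic absolute
values of `ℚ`, and `c_k ^ (-ord)` for a closed point of a curve. -/
def IsAbs : (b : BaseField K₀) → b.BasePlace → AbsoluteValue K₀ ℝ → Prop
  | rational e, ⟨none⟩, w => ∀ x, w x = |((e x : ℚ) : ℝ)|
  | rational e, ⟨some p⟩, w => ∀ x, w x = ((padicNorm p (e x) : ℚ) : ℝ)
  | functionField k _ _, v, w =>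
      ∀ (ϖ : (v : ClosedPoint k).localRing) (ε : (v : ClosedPoint k).localRingˣ) (m : ℤ),
        Irreducible ϖ → w ((ε : (v : ClosedPoint k).localRing) * (ϖ : K₀) ^ m)
          = curveConstant k ^ (-m)

/-- The weight `n_{v₀}` of a place of the base field. -/
def baseWeight : (b : BaseField K₀) → b.BasePlace → ℝ
  | rational _, _ => 1
  | functionField k _ _, v => (v : ClosedPoint k).degree

end BaseField

/-- A place of a finite extension `K` of a base field `K₀`: an absolute value on `K` that extends
the normalized absolute value of a place of `K₀`. -/
structure Place {K₀ : Type u} [Field K₀] (b : BaseField K₀) (K : Type w) [Field K]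
    [Algebra K₀ K] where
  abv : AbsoluteValue K ℝ
  base : b.BasePlace
  extends_base : b.IsAbs base (abv.comp (algebraMap K₀ K).injective)

namespace Place

variable {K₀ : Type u} [Field K₀] {b : BaseField K₀} {K : Type w} [Field K] [Algebra K₀ K]

/-- The completion `K_v`. -/
abbrev Completed (v : Place b K) : Type w := v.abv.Completion

/-- The embedding of `K₀` in `K_v`. -/
def embedBase (v : Place b K) : K₀ →+* v.Completed :=
  (UniformSpace.Completion.coeRingHom).comp
    (((WithAbs.equiv v.abv).symm : K →+* WithAbs v.abv).comp (algebraMap K₀ K))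

/-- The completion `K_{0,v₀}`, as the closure of `K₀` in `K_v`. -/
def completedBase (v : Place b K) : Subfield v.Completed :=
  v.embedBase.fieldRange.topologicalClosure

/-- The weight `n_v = [K_v : K_{0,v₀}] / [K : K₀] * n_{v₀}`. -/
def weight (v : Place b K) : ℝ :=
  (Module.finrank v.completedBase v.Completed : ℝ) / (Module.finrank K₀ K : ℝ)
    * b.baseWeight v.base

end Place

/-! ## Convex analysis

The cocharacter space `N_ℝ` and the character space `M_ℝ` are both `Fin n → ℝ` (a splitting of
the torus is fixed), with the lattices `Fin n → ℤ` and the pairing `x ⬝ᵥ u`. -/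

section Convex

variable {n : ℕ}

/-- The sup-differential at `x` of a concave function `g` on `C`. -/
def supDifferential (C : Set (Fin n → ℝ)) (g : (Fin n → ℝ) → ℝ) (x : Fin n → ℝ) :
    Set (Fin n → ℝ) :=
  {u | ∀ z ∈ C, g z - g x ≤ (z - x) ⬝ᵥ u}

/-- Faces of a convex set: the nonempty convex subsets that contain every segment of the set whose
relative interior they meet. A vertex is a face with one element, that is, an extreme point. -/
def IsFace (E F : Set (Fin n → ℝ)) : Prop :=
  F.Nonempty ∧ Convex ℝ F ∧ IsExtreme ℝ E F

/-- The minimal face of `E` containing `B`. -/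
def minimalFace (E B : Set (Fin n → ℝ)) : Set (Fin n → ℝ) :=
  ⋂₀ {F | IsFace E F ∧ B ⊆ F}

/-- The points of `C` where `g` attains its maximum over `C`. -/
def maxSet (C : Set (Fin n → ℝ)) (g : (Fin n → ℝ) → ℝ) : Set (Fin n → ℝ) :=
  {x | x ∈ C ∧ ∀ z ∈ C, g z ≤ g x}

/-- `∂g₁(x) ∩ (-∂g₂(x))`, the set `B(g₁, g₂)` computed at the point `x`. -/
def setB (C : Set (Fin n → ℝ)) (g₁ g₂ : (Fin n → ℝ) → ℝ) (x : Fin n → ℝ) : Set (Fin n → ℝ) :=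
  {u | u ∈ supDifferential C g₁ x ∧ -u ∈ supDifferential C g₂ x}

/-- The set `F(g₁, g₂)`: the minimal face of `∂g₁(x)` that contains `B(g₁, g₂)`, for a maximum
point `x` of `g₁ + g₂`. It does not depend on `x`, hence it is also the union over all such `x`. -/
def setF (C : Set (Fin n → ℝ)) (g₁ g₂ : (Fin n → ℝ) → ℝ) : Set (Fin n → ℝ) :=
  {u | ∃ x ∈ maxSet C (fun z => g₁ z + g₂ z),
    u ∈ minimalFace (supDifferential C g₁ x) (setB C g₁ g₂ x)}

/-- The polytope `{x | x ≥ Ψ}` of a support function. -/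
def polytope (Ψ : (Fin n → ℝ) → ℝ) : Set (Fin n → ℝ) :=
  {x | ∀ u, Ψ u ≤ x ⬝ᵥ u}

/-- The real vector of a lattice vector. -/
def toReal (a : Fin n → ℤ) : Fin n → ℝ := fun i => (a i : ℝ)

end Convex

/-! ## Fans and virtual support functions -/

/-- A fan: a finite collection of strongly convex rational polyhedral cones, closed under faces,
any two of which meet in a common face. -/
structure Fan (n : ℕ) where
  cones : Set (PointedCone ℝ (Fin n → ℝ))
  finite : cones.Finite
  rational : ∀ σ ∈ cones, ∃ S : Finset (Fin n → ℤ), σ = Submodule.span _ (toReal '' (S : Set _))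
  stronglyConvex : ∀ σ ∈ cones, ∀ u ∈ σ, -u ∈ σ → u = 0
  face_mem : ∀ σ ∈ cones, ∀ τ, τ.IsFaceOf σ → τ ∈ cones
  inter_face : ∀ σ ∈ cones, ∀ τ ∈ cones, (σ ⊓ τ).IsFaceOf σ

namespace Fan

variable {n : ℕ}

/-- A complete fan; the toric variety is then proper. -/
def IsComplete (X : Fan n) : Prop := ∀ u, ∃ σ ∈ X.cones, u ∈ σ

/-- Virtual support functions: these are the toric `ℝ`-divisors `D` on the toric variety. -/
def IsVirtualSupport (X : Fan n) (Ψ : (Fin n → ℝ) → ℝ) : Prop :=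
  ∀ σ ∈ X.cones, ∃ m : Fin n → ℝ, ∀ u ∈ σ, Ψ u = m ⬝ᵥ u

/-- Virtual support functions with integral slopes: these are the toric Cartier divisors. -/
def IsIntegralVirtualSupport (X : Fan n) (Ψ : (Fin n → ℝ) → ℝ) : Prop :=
  ∀ σ ∈ X.cones, ∃ m : Fin n → ℤ, ∀ u ∈ σ, Ψ u = toReal m ⬝ᵥ u

end Fan

/-- The semigroup `M_σ` of the lattice characters that are nonnegative on a cone. -/
def dualMonoid {n : ℕ} (σ : PointedCone ℝ (Fin n → ℝ)) : AddSubmonoid (Fin n → ℤ) where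
  carrier := {m | ∀ u ∈ σ, 0 ≤ toReal m ⬝ᵥ u}
  zero_mem' := by
    intro u _
    simp [toReal, dotProduct]
  add_mem' := by
    intro a b ha hb u hu
    have h : toReal (a + b) ⬝ᵥ u = toReal a ⬝ᵥ u + toReal b ⬝ᵥ u := by
      simp [toReal, dotProduct, add_mul, Finset.sum_add_distrib]
    rw [h]
    exact add_nonneg (ha u hu) (hb u hu)

/-! ## Analytifications -/

/-- The analytification of `Spec A` over a valued field `L`: multiplicative seminorms on `A` that
extend the absolute value of `L`. Over `ℂ` and `ℝ` these are the complex points, respectively the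
complex points up to conjugation; over a non-Archimedean field this is the Berkovich space. -/
structure AnPoint (L : Type w) [NormedField L] (A : Type w) [CommRing A] [Algebra L A] where
  seminorm : MulRingSeminorm A
  extends_norm : ∀ a : L, seminorm (algebraMap L A a) = ‖a‖

namespace AnPoint

variable {L : Type w} [NormedField L] {A B : Type w} [CommRing A] [Algebra L A] [CommRing B]
  [Algebra L B]

/-- The coarsest topology that makes all the functions `p ↦ |f|_p` continuous. -/
instance : TopologicalSpace (AnPoint L A) :=
  TopologicalSpace.induced (fun p (f : A) => p.seminorm f) inferInstance

/-- The map of analytifications induced by a morphism of algebras. -/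
def comap (φ : A →ₐ[L] B) (p : AnPoint L B) : AnPoint L A where
  seminorm :=
    { toFun := fun f => p.seminorm (φ f)
      map_zero' := by simp
      add_le' := fun f g => by
        rw [map_add]
        exact map_add_le_add _ _ _
      neg' := fun f => by
        rw [map_neg]
        exact map_neg_eq_map _ _
      map_one' := by simp
      map_mul' := fun f g => by simp }
  extends_norm := fun a => by
    change p.seminorm (φ (algebraMap L A a)) = ‖a‖
    rw [AlgHom.commutes]
    exact p.extends_norm a

end AnPoint

section Torus

variable (L : Type w) [NormedField L] (n : ℕ)

/-- The analytification of the split torus. -/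
abbrev TorusAn : Type w := AnPoint L (AddMonoidAlgebra L (Fin n → ℤ))

/-- The analytification of the affine toric variety `X_σ`. -/
abbrev ChartAn {n : ℕ} (σ : PointedCone ℝ (Fin n → ℝ)) : Type w :=
  AnPoint L (AddMonoidAlgebra L (dualMonoid σ))

variable {L n}

/-- The inclusion of the torus in the affine toric variety `X_σ`. -/
def TorusAn.toChart (σ : PointedCone ℝ (Fin n → ℝ)) : TorusAn L n → ChartAn L σ :=
  AnPoint.comap (AddMonoidAlgebra.mapDomainAlgHom L L (dualMonoid σ).subtype)

/-- The valuation map `(- log |x₁|, …, - log |xₙ|)` on the torus. -/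
def TorusAn.val (p : TorusAn L n) : Fin n → ℝ :=
  fun i => -Real.log (p.seminorm (AddMonoidAlgebra.single (Pi.single i 1) 1))

end Torus

/-! ## Toric metrics -/

/-- A toric (continuous) metric over `L` on the toric `ℝ`-divisor with virtual support function `Ψ`,
given by the function `‖s_D‖` on the torus, where `s_D` is the canonical rational section. On the
chart of a cone `σ` on which `Ψ` is the linear function `m`, the divisor has the local frame
`χ^m s_D`, and `|χ^m| = exp (- ⟨m, val⟩)`. The metric is toric if it is invariant under the
compact torus, whose orbits are the fibers of the valuation map. -/
structure ToricMetric (L : Type w) [NormedField L] {n : ℕ} (X : Fan n)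
    (Ψ : (Fin n → ℝ) → ℝ) where
  normSec : TorusAn L n → ℝ
  normSec_pos : ∀ p, 0 < normSec p
  extends_to_chart : ∀ σ ∈ X.cones, ∀ m : Fin n → ℝ, (∀ u ∈ σ, Ψ u = m ⬝ᵥ u) →
    ∃ g : ChartAn L σ → ℝ, Continuous g ∧ (∀ q, 0 < g q) ∧
      ∀ p : TorusAn L n, g (p.toChart σ) = normSec p * Real.exp (-(m ⬝ᵥ p.val))
  invariant : ∀ p q : TorusAn L n, p.val = q.val → normSec p = normSec q

/-- A finite nonempty family of nonzero multiples `c_j f_j` (with `c_j` a positive real number) of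
global sections `f_j s_E` of the toric Cartier divisor `E` with support function `Ψ`, that have no
common zero on the torus. It defines the Fubini-Study type metric
`‖s_E(p)‖ = (max_j c_j |f_j(p)|)⁻¹`. -/
structure SectionFamily (L : Type w) [NormedField L] {n : ℕ} (Ψ : (Fin n → ℝ) → ℝ) where
  len : ℕ
  sec : Fin (len + 1) → AddMonoidAlgebra L (Fin n → ℤ)
  scale : Fin (len + 1) → ℝ
  scale_pos : ∀ j, 0 < scale j
  isSection : ∀ j, ∀ a ∈ (sec j).coeff.support, toReal a ∈ polytope Ψ
  noCommonZero : ∀ p : TorusAn L n, ∃ j, p.seminorm (sec j) ≠ 0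

/-- `max_j c_j |f_j(p)|`. -/
def SectionFamily.size {L : Type w} [NormedField L] {n : ℕ} {Ψ : (Fin n → ℝ) → ℝ}
    (s : SectionFamily L Ψ) (p : TorusAn L n) : ℝ :=
  ⨆ j, s.scale j * p.seminorm (s.sec j)

namespace ToricMetric

variable {L : Type w} [NormedField L] {n : ℕ} {X : Fan n} {Ψ : (Fin n → ℝ) → ℝ}

/-- The canonical metric: `log ‖s_D(p)‖ = Ψ (val p)`. -/
def IsCanonical (h : ToricMetric L X Ψ) : Prop :=
  ∀ p : TorusAn L n, Real.log (h.normSec p) = Ψ p.val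

/-- A metric is semipositive if it is a uniform limit of positive real combinations
`D = ∑ αᵢ Eᵢ` of toric Cartier divisors with Fubini-Study type metrics. (The uniform bound also
excludes common zeros of the sections on the boundary of the toric variety.) -/
def IsSemipositive (h : ToricMetric L X Ψ) : Prop :=
  ∀ ε : ℝ, 0 < ε → ∃ (r : ℕ) (α : Fin r → ℝ) (E : Fin r → (Fin n → ℝ) → ℝ)
    (s : ∀ i, SectionFamily L (E i)),
    (∀ i, 0 < α i) ∧ (∀ i, X.IsIntegralVirtualSupport (E i)) ∧
    (∀ u, Ψ u = ∑ i, α i * E i u) ∧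
    ∀ p : TorusAn L n,
      |Real.log (h.normSec p) - ∑ i, α i * (-Real.log ((s i).size p))| ≤ ε

open Classical in
/-- The metric function `ψ`, determined by `ψ (val p) = log ‖s_D(p)‖`. -/
def metricFunction (h : ToricMetric L X Ψ) (u : Fin n → ℝ) : ℝ :=
  if hu : ∃ p : TorusAn L n, p.val = u then Real.log (h.normSec hu.choose) else 0

end ToricMetric

/-! ## Toric metrized divisors -/

/-- A toric metrized `ℝ`-divisor on a proper toric variety of dimension `n` over the global field
`K`: a complete fan, a virtual support function `Ψ_D`, and a toric metric for every place, with the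
metric canonical for all but finitely many places (that is, the family is quasi-algebraic: outside
finitely many places it is given by a model, which can be taken to be the canonical toric one). -/
structure ToricMetrizedDivisor {K₀ : Type u} [Field K₀] (b : BaseField K₀) (K : Type w) [Field K]
    [Algebra K₀ K] (n : ℕ) where
  fan : Fan n
  complete : fan.IsComplete
  supp : (Fin n → ℝ) → ℝ
  isSupport : fan.IsVirtualSupport supp
  metric : ∀ v : Place b K, ToricMetric v.Completed fan supp
  quasiAlgebraic : {v : Place b K | ¬ (metric v).IsCanonical}.Finite

namespace ToricMetrizedDivisor

variable {K₀ : Type u} [Field K₀] {b : BaseField K₀} {K : Type w} [Field K] [Algebra K₀ K] {n : ℕ}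
  (D : ToricMetrizedDivisor b K n)

def IsSemipositive : Prop := ∀ v, (D.metric v).IsSemipositive

/-- The polytope `Δ_D`. -/
def Δ : Set (Fin n → ℝ) := polytope D.supp

/-- `D` is big. -/
def IsBig : Prop := (interior D.Δ).Nonempty

/-- The metric function `ψ_{D,v}`. -/
def ψ (v : Place b K) : (Fin n → ℝ) → ℝ := (D.metric v).metricFunction

/-- The `v`-adic roof function `ϑ_{D,v}`, the Legendre-Fenchel dual of `ψ_{D,v}`. Only its values
on `Δ_D` are meaningful. -/
def localRoof (v : Place b K) (x : Fin n → ℝ) : ℝ := ⨅ u : Fin n → ℝ, x ⬝ᵥ u - D.ψ v u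

/-- The global roof function `ϑ_D`. -/
def roof (x : Fin n → ℝ) : ℝ := ∑ᶠ v : Place b K, v.weight * D.localRoof v x

/-- The function `g_{2,v} = ∑_{w ≠ v} (n_w / n_v) ϑ_{D,w}`. -/
def otherRoof (v : Place b K) (x : Fin n → ℝ) : ℝ :=
  ∑ᶠ w : {w : Place b K // w ≠ v}, w.1.weight / v.weight * D.localRoof w.1 x

/-- The set `F_v`. -/
def F (v : Place b K) : Set (Fin n → ℝ) := setF D.Δ (D.localRoof v) (D.otherRoof v)

/-- The set `Δ_{D,max}` of the maximum points of the global roof function. -/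
def Δmax : Set (Fin n → ℝ) := maxSet D.Δ D.roof

variable (b K n) in
/-- The set `𝓗_K` of centered adelic measures. -/
def centeredAdelicMeasures : Set (Place b K → ProbabilityMeasure (Fin n → ℝ)) :=
  {ν | (∀ v, Integrable (fun u : Fin n → ℝ => u) (ν v : Measure (Fin n → ℝ))) ∧
    {v | (ν v : Measure (Fin n → ℝ)) ≠ Measure.dirac 0}.Finite ∧
    ∑ᶠ v, v.weight • ∫ u, u ∂(ν v : Measure (Fin n → ℝ)) = 0}

/-- The function `η_D` on centered adelic measures. -/
def η (ν : Place b K → ProbabilityMeasure (Fin n → ℝ)) : ℝ :=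
  -∑ᶠ v, v.weight * ∫ u, D.ψ v u ∂(ν v : Measure (Fin n → ℝ))

/-- `η_D` attains its minimum over `𝓗_K` at `ν`. -/
def IsMinimizer (ν : Place b K → ProbabilityMeasure (Fin n → ℝ)) : Prop :=
  ν ∈ centeredAdelicMeasures b K n ∧ ∀ ν' ∈ centeredAdelicMeasures b K n, D.η ν ≤ D.η ν'

/-- The minimum of `η_D` is attained at a unique point of `𝓗_K`. -/
def IsMonocritical : Prop := ∃! ν, D.IsMinimizer ν

variable (b K n) in
/-- The subspace `H_K` of `⨁_v N_ℝ`. -/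
def adelicHyperplane : Set (Place b K →₀ (Fin n → ℝ)) :=
  {u | u.sum (fun v x => v.weight • x) = 0}

/-- The adelic measure `(δ_{u_v})_v`. -/
def diracFamily (u : Place b K →₀ (Fin n → ℝ)) (v : Place b K) :
    ProbabilityMeasure (Fin n → ℝ) :=
  ⟨Measure.dirac (u v), inferInstance⟩

/-- `u ∈ H_K` is the critical point of `D`: `(δ_{u_v})_v` is the unique minimum point of `η_D`. -/
def IsCriticalPoint (u : Place b K →₀ (Fin n → ℝ)) : Prop :=
  u ∈ adelicHyperplane b K n ∧ ∀ ν, D.IsMinimizer ν ↔ ν = diracFamily u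

/-- The set `H_K ∩ ∏_v ∂ϑ_{D,v}(x)`. -/
def adelicSolutions (x : Fin n → ℝ) : Set (Place b K →₀ (Fin n → ℝ)) :=
  {u | u ∈ adelicHyperplane b K n ∧ ∀ v, u v ∈ supDifferential D.Δ (D.localRoof v) x}

end ToricMetrizedDivisor

end ToricHeights

end

open MeasureTheory

noncomputable section

namespace ToricHeights

universe u w

/-! Concave duality turns the minimization of `η` into convex geometry. For `x` in `Δ_D` one has
`ψ_v(u) ≤ ⟨x, u⟩ - ϑ_v(x)`, with equality exactly on `∂ϑ_v(x)`
(`IsMetricFunction.mem_supDifferential_iff`). Integrating against a centered family and summing with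
the weights cancels the linear terms. Hence `η(ν) ≥ ϑ(x)`, with equality if and only if every `ν_v`
is carried by `∂ϑ_v(x)` (`roof_le_η`). If `x` maximizes `ϑ`, then `0 ∈ ∂ϑ(x)`, and the sum rule
`exists_decomposition_of_mem_supDifferential_sum` writes `0 = ∑ n_v u_v` with `u_v ∈ ∂ϑ_v(x)`. The
corresponding Dirac family attains the bound, so the minimizers are exactly the centered families
carried by the sets `∂ϑ_v(x)`, whichever maximum point `x` is used (`isMinimizer_iff`).

The barycenters of a minimizer form an adelic solution, and a probability measure on a closed convex
set whose barycenter is a vertex is a Dirac mass (`eq_dirac_of_integral_mem_extremePoints`). A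
unique solution made of vertices therefore gives a unique minimizer. Conversely, a second solution,
or a component `u_v` inside a segment, produces another minimizer, in the latter case with two atoms
at `v`. By the sum rule, a unique solution made of vertices amounts to `0` being a vertex of
`∂ϑ(x)`. The sets `F_v` enter because each `u_v` lies in `∂g₁(x) ∩ (-∂g₂(x))`.

The arithmetic and analytic input is that all weights are positive and that each `ψ_v` is concave
and at bounded distance from `Ψ_D`. The bound comes from compactness of part of each toric chart.
Concavity comes from Gauss points at non-Archimedean places and from the three lines theorem at
Archimedean ones. -/

/-! ### Positivity of the weights -/

theorem one_lt_curveConstant {F : Type u} [Field F] (k : Subfield F) : 1 < curveConstant k := by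
  unfold curveConstant
  split_ifs with h
  · exact_mod_cast Finite.one_lt_card
  · exact Real.one_lt_exp_iff.mpr one_pos

namespace ClosedPoint

variable {F : Type u} [Field F] {k : Subfield F}

theorem degree_pos (v : ClosedPoint k) : 0 < v.degree := by
  let : Module k (IsLocalRing.ResidueField v.localRing) := v.residueMap.toModule
  have : Module.Finite k (IsLocalRing.ResidueField v.localRing) := v.residue_finite
  exact Module.finrank_pos

end ClosedPoint

namespace BaseField

variable {K₀ : Type u} [Field K₀]

theorem baseWeight_pos (b : BaseField K₀) (v : b.BasePlace) : 0 < b.baseWeight v := by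
  cases b with
  | rational e => exact one_pos
  | functionField k _ _ => exact Nat.cast_pos.mpr (ClosedPoint.degree_pos (k := k) v)

/-- Nontriviality of the absolute value is what makes finite-dimensional subspaces over the
completed base field closed. -/
theorem IsAbs.exists_one_lt {b : BaseField K₀} {v : b.BasePlace} {a : AbsoluteValue K₀ ℝ}
    (h : b.IsAbs v a) : ∃ x, 1 < a x := by
  cases b with
  | rational e =>
    match v, h with
    | ⟨none⟩, h =>
      refine ⟨e.symm 2, ?_⟩
      rw [h, RingEquiv.apply_symm_apply]
      norm_num
    | ⟨some p⟩, h =>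
      have := p.2.two_le
      refine ⟨e.symm (p : ℚ)⁻¹, ?_⟩
      have : Fact (p : ℕ).Prime := ⟨p.2⟩
      have hp : (1 : ℝ) < (p : ℕ) := by exact_mod_cast p.2.one_lt
      rw [h, RingEquiv.apply_symm_apply, ← one_div, padicNorm.div,
        padicNorm.padicNorm_p_of_prime]
      simpa using hp
  | functionField k _ _ =>
    change ClosedPoint k at v
    have := v.isDiscrete
    obtain ⟨ϖ, hϖ⟩ := IsDiscreteValuationRing.exists_irreducible v.localRing
    refine ⟨((1 : v.localRingˣ) : v.localRing) * (ϖ : K₀) ^ (-1 : ℤ), ?_⟩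
    rw [h ϖ 1 (-1) hϖ]
    simpa using one_lt_curveConstant k

/-- The normalized absolute values of a base field are either non-Archimedean, or the usual one on
`ℚ`. -/
theorem IsAbs.natCast_le_one_or {b : BaseField K₀} {v : b.BasePlace} {a : AbsoluteValue K₀ ℝ}
    (h : b.IsAbs v a) :
    (∀ n : ℕ, a n ≤ 1) ∨ ∃ e : K₀ ≃+* ℚ, ∀ x, a x = |((e x : ℚ) : ℝ)| := by
  cases b with
  | rational e =>
    match v, h with
    | ⟨none⟩, h => exact Or.inr ⟨e, h⟩
    | ⟨some p⟩, h =>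
      have : Fact (p : ℕ).Prime := ⟨p.2⟩
      refine Or.inl fun n => ?_
      rw [h]
      have := padicNorm.of_nat (p := p) n
      rw [map_natCast]
      exact_mod_cast this
  | functionField k _ _ =>
    change ClosedPoint k at v
    have := v.isDiscrete
    refine Or.inl fun n => ?_
    obtain ⟨ϖ, hϖ⟩ := IsDiscreteValuationRing.exists_irreducible v.localRing
    by_cases hn : (n : v.localRing) = 0
    · have : (n : K₀) = 0 := by simpa using congrArg (Subtype.val) hn
      simp [this]
    · obtain ⟨m, ε, hm⟩ := IsDiscreteValuationRing.eq_unit_mul_pow_irreducible hn hϖ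
      have h2 := h ϖ ε m hϖ
      have h3 : (n : K₀) = (ε : v.localRing) * (ϖ : K₀) ^ (m : ℤ) := by
        simpa using congrArg (Subtype.val) hm
      rw [h3, h2]
      exact zpow_le_one_of_nonpos₀ (one_lt_curveConstant k).le (by simp)

end BaseField

/-- A normed field with a dense subfield that is finite over a subfield of a complete field `𝕜` is
finite over `𝕜`. -/
theorem finite_of_denseRange {K₀ K 𝕜 L : Type*} [Field K₀] [Field K] [Algebra K₀ K]
    [FiniteDimensional K₀ K] [NontriviallyNormedField 𝕜] [CompleteSpace 𝕜] [NormedField L]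
    [NormedAlgebra 𝕜 L] (i : K₀ →+* 𝕜) (c : K →+* L)
    (hc : ∀ x, c (algebraMap K₀ K x) = algebraMap 𝕜 L (i x)) (hd : DenseRange c) :
    Module.Finite 𝕜 L := by
  let B := Module.finBasis K₀ K
  -- The span of the image of a `K₀`-basis of `K` is closed, being finite-dimensional over a
  -- complete field, and it contains the dense image of `K`.
  let W : Submodule 𝕜 L := Submodule.span _ (Set.range fun i => c (B i))
  have : FiniteDimensional 𝕜 W := FiniteDimensional.span_of_finite _ (Set.finite_range _)
  have hW : IsClosed (W : Set L) := Submodule.closed_of_finiteDimensional W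
  have hcW : ∀ y, c y ∈ W := by
    intro y
    rw [← B.sum_repr y, map_sum]
    refine Submodule.sum_mem _ fun j _ => ?_
    rw [Algebra.smul_def, map_mul, hc, ← Algebra.smul_def]
    exact Submodule.smul_mem W _ (Submodule.subset_span ⟨j, rfl⟩)
  have htop : W = ⊤ := by
    rw [eq_top_iff]
    intro z _
    have : closure (Set.range c) ⊆ W :=
      closure_minimal (Set.range_subset_iff.mpr hcW) hW
    exact this (hd z)
  exact Module.finite_def.mpr (htop ▸ Submodule.fg_span (Set.finite_range _))

namespace Place

variable {K₀ : Type u} [Field K₀] {b : BaseField K₀} {K : Type w} [Field K] [Algebra K₀ K]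

theorem norm_embedBase (v : Place b K) (x : K₀) :
    ‖v.embedBase x‖ = v.abv (algebraMap K₀ K x) := by
  unfold embedBase
  exact UniformSpace.Completion.norm_coe _

/-- Finiteness of the local extension is needed for positive weights, because `Module.finrank` is
zero on an infinite extension. -/
theorem finite_completed [FiniteDimensional K₀ K] (v : Place b K) :
    Module.Finite v.completedBase v.Completed := by
  have hmem : ∀ x, v.embedBase x ∈ v.completedBase := fun x =>
    Subfield.le_topologicalClosure _ ⟨x, rfl⟩
  let : NontriviallyNormedField v.completedBase :=
    { (inferInstance : NormedField v.completedBase) with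
      non_trivial := by
        obtain ⟨x, hx⟩ := v.extends_base.exists_one_lt
        refine ⟨⟨v.embedBase x, hmem x⟩, ?_⟩
        change 1 < ‖v.embedBase x‖
        rw [norm_embedBase]
        exact hx }
  have : CompleteSpace v.completedBase :=
    (Subfield.isClosed_topologicalClosure _).completeSpace_coe
  let : NormedAlgebra v.completedBase v.Completed :=
    { (inferInstance : Algebra v.completedBase v.Completed) with
      norm_smul_le := fun r x => by
        rw [Algebra.smul_def, norm_mul]
        exact le_rfl }
  exact finite_of_denseRange (𝕜 := v.completedBase) (L := v.Completed)
    (v.embedBase.codRestrict v.completedBase hmem)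
    ((UniformSpace.Completion.coeRingHom).comp
      ((WithAbs.equiv v.abv).symm : K →+* WithAbs v.abv))
    (fun x => rfl)
    ((UniformSpace.Completion.denseRange_coe).comp
      (WithAbs.equiv v.abv).symm.surjective.denseRange
      (UniformSpace.Completion.continuous_coe _))

theorem weight_pos [FiniteDimensional K₀ K] (v : Place b K) : 0 < v.weight := by
  have := v.finite_completed
  refine mul_pos (div_pos ?_ ?_) (b.baseWeight_pos _)
  · exact Nat.cast_pos.mpr Module.finrank_pos
  · exact Nat.cast_pos.mpr Module.finrank_pos

end Place

/-! ### Archimedean and non-Archimedean completions -/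

/-- A complete normed field whose norm restricts to the usual absolute value of `ℚ` embeds in
`ℂ`. -/
theorem exists_isometric_ringHom_complex (L : Type w) [NormedField L] [CompleteSpace L]
    [CharZero L] (hq : ∀ q : ℚ, ‖(q : L)‖ = |(q : ℝ)|) :
    ∃ ι : L →+* ℂ, ∀ x, ‖ι x‖ = ‖x‖ := by
  have ui : IsUniformInducing (Rat.castHom ℝ) :=
    Rat.isUniformEmbedding_coe_real.isUniformInducing
  have hd : DenseRange (Rat.castHom ℝ) := Rat.denseRange_cast
  have hiso : Isometry (Rat.castHom L) := by
    refine Isometry.of_dist_eq fun x y => ?_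
    rw [dist_eq_norm, ← map_sub, Rat.dist_eq]
    simpa using hq (x - y)
  -- The isometric embedding of `ℚ` extends by density to `ℝ`, so `L` becomes a normed real algebra
  -- and is isomorphic to `ℝ` or `ℂ`. That isomorphism is not known to be isometric yet.
  let φ : ℝ →+* L := IsDenseInducing.extendRingHom ui hd hiso.uniformContinuous
  have hφq : ∀ q : ℚ, φ q = q := fun q => by simp
  have hφc : Continuous φ :=
    uniformContinuous_uniformly_extend ui hd hiso.uniformContinuous |>.continuous
  have hφ : ∀ r : ℝ, ‖φ r‖ = |r| := by
    intro r
    have := hd.equalizer (hφc.norm) continuous_abs (by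
      funext q
      simp only [Function.comp, Rat.coe_castHom, hφq, hq])
    exact congrFun this r
  let : NormedAlgebra ℝ L := { φ.toAlgebra with
    norm_smul_le := fun r x => by
      change ‖φ r * x‖ ≤ _
      rw [norm_mul, hφ, Real.norm_eq_abs] }
  obtain ⟨ι⟩ : Nonempty (L →ₐ[ℝ] ℂ) := by
    rcases NormedAlgebra.Real.nonempty_algEquiv_or L with ⟨⟨e⟩⟩ | ⟨⟨e⟩⟩
    · exact ⟨(Algebra.ofId ℝ ℂ).comp e.toAlgHom⟩
    · exact ⟨e.toAlgHom⟩
  have hfin : FiniteDimensional ℝ L :=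
    FiniteDimensional.of_injective ι.toLinearMap ι.injective
  obtain ⟨C, hC0, hC⟩ : ∃ C : ℝ, 0 < C ∧ ∀ x, ‖ι x‖ ≤ C * ‖x‖ := by
    obtain ⟨C, h0, hC⟩ := (LinearMap.toContinuousLinearMap ι.toLinearMap).bound
    exact ⟨C, h0, hC⟩
  -- Applying the bound with constant `C` to `x ^ m` for large `m` removes the constant. The reverse
  -- inequality follows by passing to `x⁻¹`.
  have hle : ∀ x, ‖ι x‖ ≤ ‖x‖ := by
    intro x
    by_contra! hlt
    have hx0 : 0 < ‖x‖ := by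
      rcases (norm_nonneg x).eq_or_lt with h | h
      · rw [norm_eq_zero.mp h.symm] at hlt; simp at hlt
      · exact h
    obtain ⟨m, hm⟩ := pow_unbounded_of_one_lt C ((one_lt_div hx0).mpr hlt)
    have := hC (x ^ m)
    rw [map_pow, norm_pow, norm_pow] at this
    rw [div_pow, lt_div_iff₀ (by positivity)] at hm
    linarith
  refine ⟨ι, fun x => ?_⟩
  refine le_antisymm (hle x) ?_
  by_cases hx : x = 0
  · simp [hx]
  have := hle x⁻¹
  rw [map_inv₀, norm_inv, norm_inv] at this
  exact (inv_le_inv₀ (norm_pos_iff.mpr (by simpa using hx)) (norm_pos_iff.mpr hx)).mp this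

namespace Place

variable {K₀ : Type u} [Field K₀] {b : BaseField K₀} {K : Type w} [Field K] [Algebra K₀ K]

theorem isUltrametricDist_or (v : Place b K) :
    IsUltrametricDist v.Completed ∨ ∃ ι : v.Completed →+* ℂ, ∀ x, ‖ι x‖ = ‖x‖ := by
  rcases v.extends_base.natCast_le_one_or with h | ⟨e, he⟩
  · refine Or.inl (IsUltrametricDist.isUltrametricDist_of_forall_norm_natCast_le_one fun n => ?_)
    have := h n
    rw [← map_natCast v.embedBase n, norm_embedBase]
    exact this
  · have : CharZero K₀ := charZero_of_injective_ringHom (f := (e.symm : ℚ →+* K₀)) e.symm.injective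
    have : CharZero v.Completed := charZero_of_injective_ringHom v.embedBase.injective
    refine Or.inr (exists_isometric_ringHom_complex _ fun q => ?_)
    rw [← map_ratCast v.embedBase q, norm_embedBase]
    have : v.abv (algebraMap K₀ K q) = |((e q : ℚ) : ℝ)| := he q
    rwa [map_ratCast e, Rat.cast_id] at this

end Place

open scoped NNReal

/-! ## Gauss norms on group algebras -/

section Gauss

variable {L : Type*} [NormedField L] {G : Type*}

/-- The weighted Gauss norm `max ‖f_m‖ r(m)` on a group algebra. -/
def gaussSup (r : G → ℝ≥0) (f : AddMonoidAlgebra L G) : ℝ≥0 :=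
  f.coeff.support.sup fun m => ‖f.coeff m‖₊ * r m

theorem gaussSup_le_iff {r : G → ℝ≥0} {f : AddMonoidAlgebra L G} {C : ℝ≥0} :
    gaussSup r f ≤ C ↔ ∀ m, ‖f.coeff m‖₊ * r m ≤ C := by
  rw [gaussSup, Finset.sup_le_iff]
  refine ⟨fun h m => ?_, fun h m _ => h m⟩
  by_cases hm : m ∈ f.coeff.support
  · exact h m hm
  · simp [Finsupp.notMem_support_iff.mp hm]

theorem le_gaussSup (r : G → ℝ≥0) (f : AddMonoidAlgebra L G) (m : G) :
    ‖f.coeff m‖₊ * r m ≤ gaussSup r f := gaussSup_le_iff.mp le_rfl m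

theorem gaussSup_single (r : G → ℝ≥0) (m : G) (a : L) :
    gaussSup r (AddMonoidAlgebra.single m a) = ‖a‖₊ * r m := by
  refine le_antisymm (gaussSup_le_iff.mpr fun k => ?_) ?_
  · by_cases h : m = k
    · subst h; simp
    · simp [h]
  · simpa using le_gaussSup r (AddMonoidAlgebra.single m a) m

theorem gaussSup_zero (r : G → ℝ≥0) : gaussSup r (0 : AddMonoidAlgebra L G) = 0 := by
  simp [gaussSup]

theorem gaussSup_neg (r : G → ℝ≥0) (f : AddMonoidAlgebra L G) :
    gaussSup r (-f) = gaussSup r f := by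
  simp [gaussSup]

theorem gaussSup_add_le_max [IsUltrametricDist L] (r : G → ℝ≥0) (f g : AddMonoidAlgebra L G) :
    gaussSup r (f + g) ≤ max (gaussSup r f) (gaussSup r g) := by
  refine gaussSup_le_iff.mpr fun m => ?_
  rw [AddMonoidAlgebra.coeff_add, Finsupp.add_apply]
  calc ‖f.coeff m + g.coeff m‖₊ * r m ≤ max ‖f.coeff m‖₊ ‖g.coeff m‖₊ * r m := by
        gcongr
        exact IsUltrametricDist.nnnorm_add_le_max _ _
    _ = max (‖f.coeff m‖₊ * r m) (‖g.coeff m‖₊ * r m) := max_mul_of_nonneg _ _ zero_le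
    _ ≤ _ := max_le_max (le_gaussSup r f m) (le_gaussSup r g m)

theorem gaussSup_add_le [IsUltrametricDist L] {r : G → ℝ≥0} {f g : AddMonoidAlgebra L G} {C : ℝ≥0}
    (hf : gaussSup r f ≤ C) (hg : gaussSup r g ≤ C) : gaussSup r (f + g) ≤ C :=
  (gaussSup_add_le_max r f g).trans (max_le hf hg)

variable [AddCommGroup G] {r : G → ℝ≥0}

theorem gaussSup_single_mul_le (hr : ∀ a b, r (a + b) = r a * r b) (m : G)
    (a : L) (g : AddMonoidAlgebra L G) :
    gaussSup r (AddMonoidAlgebra.single m a * g) ≤ ‖a‖₊ * r m * gaussSup r g := by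
  refine gaussSup_le_iff.mpr fun k => ?_
  have h1 : (AddMonoidAlgebra.single m a * g).coeff k = a * g.coeff (-m + k) := by
    simp [AddMonoidAlgebra.coeff_single_mul_apply]
  have h2 : r k = r m * r (-m + k) := by rw [← hr]; simp
  rw [h1, h2, nnnorm_mul]
  calc ‖a‖₊ * ‖g.coeff (-m + k)‖₊ * (r m * r (-m + k))
      = ‖a‖₊ * r m * (‖g.coeff (-m + k)‖₊ * r (-m + k)) := by ring
    _ ≤ _ := by gcongr; exact le_gaussSup r g _

/-- Each monomial of `f` satisfies the bound, and the ultrametric inequality propagates it to their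
sum. -/
theorem gaussSup_mul_le [IsUltrametricDist L] (hr : ∀ a b, r (a + b) = r a * r b)
    (f g : AddMonoidAlgebra L G) :
    gaussSup r (f * g) ≤ gaussSup r f * gaussSup r g := by
  have key : ∀ s : Finset G, gaussSup r ((∑ m ∈ s, AddMonoidAlgebra.single m (f.coeff m)) * g)
      ≤ gaussSup r f * gaussSup r g := by
    intro s
    classical
    induction s using Finset.induction_on with
    | empty => simp [gaussSup_zero]
    | insert a s ha ih =>
      rw [Finset.sum_insert ha, add_mul]
      refine gaussSup_add_le ?_ ih
      refine (gaussSup_single_mul_le hr _ _ _).trans ?_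
      gcongr
      exact le_gaussSup r f a
  have := key f.coeff.support
  rwa [show (∑ m ∈ f.coeff.support, AddMonoidAlgebra.single m (f.coeff m)) = f from
    AddMonoidAlgebra.sum_coeff_single f] at this

open Classical in
/-- The part of `f` with the coefficients of maximal weighted norm. -/
theorem exists_leading_part [IsUltrametricDist L] {f : AddMonoidAlgebra L G}
    (hf : 0 < gaussSup r f) :
    ∃ f₁ f₂ : AddMonoidAlgebra L G, f = f₁ + f₂ ∧ f₁.coeff.support.Nonempty ∧
      (∀ m ∈ f₁.coeff.support, ‖f₁.coeff m‖₊ * r m = gaussSup r f) ∧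
      gaussSup r f₂ < gaussSup r f := by
  let P : G → Prop := fun m => ‖f.coeff m‖₊ * r m = gaussSup r f
  refine ⟨.ofCoeff (f.coeff.filter P), .ofCoeff (f.coeff.filter fun m => ¬ P m), ?_, ?_, ?_, ?_⟩
  · apply AddMonoidAlgebra.coeff_injective
    rw [AddMonoidAlgebra.coeff_add]
    exact (Finsupp.filter_add_filter_not _ _).symm
  · have hne : f.coeff.support.Nonempty := by
      by_contra h
      rw [Finset.not_nonempty_iff_eq_empty] at h
      simp [gaussSup, h] at hf
    obtain ⟨m, hm, hm'⟩ := Finset.exists_mem_eq_sup _ hne fun m => ‖f.coeff m‖₊ * r m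
    refine ⟨m, ?_⟩
    simp only [Finsupp.support_filter, Finset.mem_filter]
    exact ⟨hm, hm'.symm⟩
  · intro m hm
    simp only [Finsupp.support_filter, Finset.mem_filter] at hm
    simp only [Finsupp.filter_apply_pos P _ hm.2]
    exact hm.2
  · rw [gaussSup, Finset.sup_lt_iff hf]
    intro m hm
    simp only [Finsupp.support_filter, Finset.mem_filter] at hm
    simp only [Finsupp.filter_apply_pos (fun m => ¬ P m) _ hm.2]
    exact lt_of_le_of_ne (le_gaussSup r f m) hm.2

/-- Gauss's lemma. The supports of the leading parts contain a pair whose sum is reached only once,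
so the corresponding coefficient of the product cannot cancel. All the other contributions have
strictly smaller norm. -/
theorem gaussSup_mul [IsUltrametricDist L] [UniqueSums G] (hr : ∀ a b, r (a + b) = r a * r b)
    (f g : AddMonoidAlgebra L G) :
    gaussSup r (f * g) = gaussSup r f * gaussSup r g := by
  refine le_antisymm (gaussSup_mul_le hr f g) ?_
  rcases eq_zero_or_pos (gaussSup r f) with h | hf
  · simp [h]
  rcases eq_zero_or_pos (gaussSup r g) with h | hg
  · simp [h]
  by_contra! hlt
  obtain ⟨f₁, f₂, rfl, hf₁, hf₁', hf₂⟩ := exists_leading_part hf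
  obtain ⟨g₁, g₂, rfl, hg₁, hg₁', hg₂⟩ := exists_leading_part hg
  set A := gaussSup r (f₁ + f₂)
  set B := gaussSup r (g₁ + g₂)
  have hf₁A : gaussSup r f₁ ≤ A := by
    have : gaussSup r (f₁ + f₂ + -f₂) ≤ A := gaussSup_add_le le_rfl (by rw [gaussSup_neg]; exact hf₂.le)
    simpa using this
  obtain ⟨a, ha, c, hc, huniq⟩ := UniqueSums.uniqueAdd_of_nonempty hf₁ hg₁
  have hcoeff : (f₁ * g₁).coeff (a + c) = f₁.coeff a * g₁.coeff c :=
    AddMonoidAlgebra.coeff_mul_add_of_uniqueAdd huniq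
  have hle : A * B ≤ gaussSup r (f₁ * g₁) := by
    have := le_gaussSup r (f₁ * g₁) (a + c)
    rw [hcoeff, hr, nnnorm_mul] at this
    rw [← hf₁' a ha, ← hg₁' c hc]
    convert this using 1
    ring
  have hdec : f₁ * g₁ = (f₁ + f₂) * (g₁ + g₂) + (-(f₂ * (g₁ + g₂)) + -(f₁ * g₂)) := by ring
  have h2 : gaussSup r (f₂ * (g₁ + g₂)) < A * B :=
    (gaussSup_mul_le hr _ _).trans_lt (mul_lt_mul_of_pos_right hf₂ hg)
  have h3 : gaussSup r (f₁ * g₂) < A * B :=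
    (gaussSup_mul_le hr _ _).trans_lt
      ((mul_le_mul_left hf₁A _).trans_lt (mul_lt_mul_of_pos_left hg₂ hf))
  have h4 : gaussSup r (f₁ * g₁) < A * B := by
    rw [hdec]
    refine (gaussSup_add_le_max _ _ _).trans_lt (max_lt hlt
      ((gaussSup_add_le_max _ _ _).trans_lt (max_lt ?_ ?_)))
    · rwa [gaussSup_neg]
    · rwa [gaussSup_neg]
  exact absurd hle (not_le.mpr h4)

end Gauss

/-! ## Points of the torus -/

namespace TorusAn

variable {L : Type w} [NormedField L] {n : ℕ}

theorem toReal_add (a b : Fin n → ℤ) : toReal (a + b) = toReal a + toReal b := by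
  funext i; simp [toReal]

/-- The Gauss point with given valuation. -/
def gaussPoint [IsUltrametricDist L] (u : Fin n → ℝ) : TorusAn L n :=
  have hr : ∀ a b : Fin n → ℤ, Real.toNNReal (Real.exp (-(toReal (a + b) ⬝ᵥ u))) =
      Real.toNNReal (Real.exp (-(toReal a ⬝ᵥ u))) * Real.toNNReal (Real.exp (-(toReal b ⬝ᵥ u))) := by
    intro a b
    rw [← Real.toNNReal_mul (Real.exp_pos _).le, ← Real.exp_add, toReal_add, add_dotProduct]
    congr 2; ring
  { seminorm :=
      { toFun := fun f =>
          (gaussSup (fun m : Fin n → ℤ => Real.toNNReal (Real.exp (-(toReal m ⬝ᵥ u)))) f : ℝ≥0)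
        map_zero' := by simp [gaussSup_zero]
        add_le' := fun f g => by
          have := (gaussSup_add_le_max
            (fun m : Fin n → ℤ => Real.toNNReal (Real.exp (-(toReal m ⬝ᵥ u)))) f g).trans
            (max_le_add_of_nonneg zero_le zero_le)
          exact_mod_cast this
        neg' := fun f => by rw [gaussSup_neg]
        map_one' := by
          rw [AddMonoidAlgebra.one_def, gaussSup_single]
          simp [toReal, dotProduct]
        map_mul' := fun f g => by
          rw [gaussSup_mul hr]
          simp }
    extends_norm := fun a => by
      change ((gaussSup _ (algebraMap L (AddMonoidAlgebra L (Fin n → ℤ)) a) : ℝ≥0) : ℝ) = ‖a‖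
      rw [AddMonoidAlgebra.coe_algebraMap]
      simp only [Function.comp, gaussSup_single]
      simp [toReal, dotProduct] }

theorem gaussPoint_seminorm [IsUltrametricDist L] (u : Fin n → ℝ)
    (f : AddMonoidAlgebra L (Fin n → ℤ)) :
    (gaussPoint u : TorusAn L n).seminorm f =
      gaussSup (fun m : Fin n → ℤ => Real.toNNReal (Real.exp (-(toReal m ⬝ᵥ u)))) f := rfl

theorem toReal_single_dotProduct (i : Fin n) (u : Fin n → ℝ) :
    toReal (Pi.single i 1) ⬝ᵥ u = u i := by
  have : toReal (Pi.single i 1 : Fin n → ℤ) = Pi.single i 1 := by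
    funext j
    by_cases h : j = i
    · subst h; simp [toReal]
    · simp [toReal, h]
  rw [this, single_one_dotProduct]

theorem gaussPoint_val [IsUltrametricDist L] (u : Fin n → ℝ) :
    (gaussPoint u : TorusAn L n).val = u := by
  funext i
  rw [val, gaussPoint_seminorm, gaussSup_single, toReal_single_dotProduct]
  simp [(Real.exp_pos _).le]

section Complex

variable (ι : L →+* ℂ) (z : Fin n → ℂ)

/-- The character `m ↦ exp (-⟨m, z⟩)`. -/
def expChar : Multiplicative (Fin n → ℤ) →* ℂ where
  toFun m := Complex.exp (-∑ i, (m.toAdd i : ℂ) * z i)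
  map_one' := by simp
  map_mul' a b := by
    rw [← Complex.exp_add]
    simp only [toAdd_mul, Pi.add_apply, Int.cast_add, add_mul, Finset.sum_add_distrib]
    ring_nf

/-- Evaluation of Laurent polynomials at the complex point `exp (-z)`. -/
def evalExp : AddMonoidAlgebra L (Fin n → ℤ) →+* ℂ :=
  AddMonoidAlgebra.liftNCRingHom ι (expChar z) fun _ _ => Commute.all _ _

theorem evalExp_single (m : Fin n → ℤ) (a : L) :
    evalExp ι z (AddMonoidAlgebra.single m a) = ι a * Complex.exp (-∑ i, (m i : ℂ) * z i) :=
  AddMonoidAlgebra.liftNCRingHom_single _ _ _ _ _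

theorem evalExp_eq_sum (f : AddMonoidAlgebra L (Fin n → ℤ)) :
    evalExp ι z f = ∑ m ∈ f.coeff.support, ι (f.coeff m) * Complex.exp (-∑ i, (m i : ℂ) * z i) := by
  conv_lhs => rw [← AddMonoidAlgebra.sum_coeff_single f, Finsupp.sum, map_sum]
  simp only [evalExp_single]

variable {ι} (hι : ∀ x, ‖ι x‖ = ‖x‖)

/-- The complex point `exp (-z)` of the torus. -/
def complexPoint : TorusAn L n where
  seminorm :=
    { toFun := fun f => ‖evalExp ι z f‖
      map_zero' := by simp
      add_le' := fun f g => by rw [map_add]; exact norm_add_le _ _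
      neg' := fun f => by rw [map_neg, norm_neg]
      map_one' := by simp
      map_mul' := fun f g => by simp }
  extends_norm := fun a => by
    change ‖evalExp ι z (algebraMap L (AddMonoidAlgebra L (Fin n → ℤ)) a)‖ = ‖a‖
    rw [AddMonoidAlgebra.coe_algebraMap]
    simp [evalExp_single, hι]

theorem complexPoint_seminorm (f : AddMonoidAlgebra L (Fin n → ℤ)) :
    (complexPoint z hι).seminorm f = ‖evalExp ι z f‖ := rfl

theorem complexPoint_val : (complexPoint z hι).val = fun i => (z i).re := by
  funext i
  rw [val, complexPoint_seminorm, evalExp_single, norm_mul, hι, Complex.norm_exp]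
  simp [Pi.single_apply]

end Complex

theorem seminorm_single_one_mul (p : TorusAn L n) (a b : Fin n → ℤ) :
    p.seminorm (AddMonoidAlgebra.single (a + b) 1) =
      p.seminorm (AddMonoidAlgebra.single a 1) * p.seminorm (AddMonoidAlgebra.single b 1) := by
  rw [← map_mul, AddMonoidAlgebra.single_mul_single, one_mul]

theorem seminorm_single_one_pos (p : TorusAn L n) (a : Fin n → ℤ) :
    0 < p.seminorm (AddMonoidAlgebra.single a 1) := by
  refine lt_of_le_of_ne (apply_nonneg _ _) fun h => ?_
  have := p.seminorm_single_one_mul a (-a)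
  rw [← h, zero_mul, add_neg_cancel, ← AddMonoidAlgebra.one_def, map_one] at this
  exact one_ne_zero this

/-- The logarithm of `|χ^m|` is additive in `m`, hence determined by the coordinate characters,
which define `val`. -/
theorem seminorm_single_one (p : TorusAn L n) (m : Fin n → ℤ) :
    p.seminorm (AddMonoidAlgebra.single m 1) = Real.exp (-(toReal m ⬝ᵥ p.val)) := by
  let φ : (Fin n → ℤ) →+ ℝ :=
    { toFun := fun m => Real.log (p.seminorm (AddMonoidAlgebra.single m 1))
      map_zero' := by rw [← AddMonoidAlgebra.one_def, map_one, Real.log_one]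
      map_add' := fun a b => by
        rw [seminorm_single_one_mul, Real.log_mul (p.seminorm_single_one_pos a).ne'
          (p.seminorm_single_one_pos b).ne'] }
  have h : φ m = -(toReal m ⬝ᵥ p.val) := by
    have hm : m = ∑ i, m i • (Pi.single i 1 : Fin n → ℤ) := by
      conv_lhs => rw [← Finset.univ_sum_single m]
      refine Finset.sum_congr rfl fun i _ => ?_
      rw [← Pi.single_smul]; simp
    conv_lhs => rw [hm]
    rw [map_sum, dotProduct, ← Finset.sum_neg_distrib]
    refine Finset.sum_congr rfl fun i _ => ?_
    rw [map_zsmul]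
    simp [φ, val, toReal]
  rw [← h]
  exact (Real.exp_log (p.seminorm_single_one_pos m)).symm

theorem seminorm_single (p : TorusAn L n) (m : Fin n → ℤ) (a : L) :
    p.seminorm (AddMonoidAlgebra.single m a) = ‖a‖ * Real.exp (-(toReal m ⬝ᵥ p.val)) := by
  rw [← seminorm_single_one, ← p.extends_norm a, ← map_mul, AddMonoidAlgebra.coe_algebraMap]
  simp [AddMonoidAlgebra.single_mul_single]

/-- The bound depends on `p` only through its valuation, which makes it uniform on vertical lines in
the three lines argument. -/
theorem seminorm_le_sum (p : TorusAn L n) (f : AddMonoidAlgebra L (Fin n → ℤ)) :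
    p.seminorm f ≤ ∑ m ∈ f.coeff.support, ‖f.coeff m‖ * Real.exp (-(toReal m ⬝ᵥ p.val)) := by
  conv_lhs => rw [← AddMonoidAlgebra.sum_coeff_single f, Finsupp.sum]
  refine (Finset.le_sum_of_subadditive p.seminorm (map_zero _).le (map_add_le_add _) _ _).trans_eq ?_
  simp only [seminorm_single]

end TorusAn

/-! ## Compactness of the bounded part of a chart -/

section Chart

/-- Tychonoff: the axioms of a multiplicative seminorm are closed conditions in the product of
copies of `ℝ` indexed by the algebra, and bounded characters force `|f| ≤ ∑ ‖f_m‖`. -/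
theorem AnPoint.isCompact_bounded {L : Type w} [NormedField L] {S : Type} [AddCommMonoid S] :
    IsCompact {q : AnPoint L (AddMonoidAlgebra L S) |
      ∀ m, q.seminorm (AddMonoidAlgebra.single m 1) ≤ 1} := by
  let A := AddMonoidAlgebra L S
  let j : AnPoint L A → A → ℝ := fun p f => p.seminorm f
  have hj : Topology.IsInducing j := ⟨rfl⟩
  rw [hj.isCompact_iff]
  let bd : A → ℝ := fun f => ∑ m ∈ f.coeff.support, ‖f.coeff m‖
  refine IsCompact.of_isClosed_subset
    (isCompact_univ_pi fun f : A => isCompact_Icc (a := (0 : ℝ)) (b := bd f)) ?_ ?_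
  · have himage : j '' {q | ∀ m, q.seminorm (AddMonoidAlgebra.single m 1) ≤ 1} =
        {φ : A → ℝ | φ 0 = 0} ∩ {φ | φ 1 = 1} ∩ {φ | ∀ f g, φ (f + g) ≤ φ f + φ g} ∩
        {φ | ∀ f, φ (-f) = φ f} ∩ {φ | ∀ f g, φ (f * g) = φ f * φ g} ∩
        {φ | ∀ a : L, φ (algebraMap L A a) = ‖a‖} ∩
        {φ | ∀ m, φ (AddMonoidAlgebra.single m 1) ≤ 1} := by
      ext φ
      constructor
      · rintro ⟨q, hq, rfl⟩
        exact ⟨⟨⟨⟨⟨⟨map_zero _, map_one q.seminorm⟩, fun f g => map_add_le_add _ _ _⟩,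
          fun f => map_neg_eq_map _ _⟩, fun f g => map_mul _ _ _⟩, q.extends_norm⟩, hq⟩
      · rintro ⟨⟨⟨⟨⟨⟨h0, h1⟩, hadd⟩, hneg⟩, hmul⟩, hL⟩, hm⟩
        exact ⟨⟨{ toFun := φ, map_zero' := h0, add_le' := hadd, neg' := hneg, map_one' := h1,
                  map_mul' := hmul }, hL⟩, hm, rfl⟩
    rw [himage]
    refine IsClosed.inter (IsClosed.inter (IsClosed.inter (IsClosed.inter (IsClosed.inter
      (IsClosed.inter ?_ ?_) ?_) ?_) ?_) ?_) ?_
    · exact isClosed_eq (continuous_apply _) continuous_const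
    · exact isClosed_eq (continuous_apply _) continuous_const
    · simp only [Set.ofPred_forall]
      exact isClosed_iInter fun f => isClosed_iInter fun g => isClosed_le (continuous_apply _)
        ((continuous_apply f).add (continuous_apply g))
    · simp only [Set.ofPred_forall]
      exact isClosed_iInter fun f => isClosed_eq (continuous_apply _) (continuous_apply _)
    · simp only [Set.ofPred_forall]
      exact isClosed_iInter fun f => isClosed_iInter fun g => isClosed_eq (continuous_apply _)
        ((continuous_apply f).mul (continuous_apply g))
    · simp only [Set.ofPred_forall]
      exact isClosed_iInter fun f => isClosed_eq (continuous_apply _) continuous_const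
    · simp only [Set.ofPred_forall]
      exact isClosed_iInter fun f => isClosed_le (continuous_apply _) continuous_const
  · rintro _ ⟨q, hq, rfl⟩ f -
    refine ⟨apply_nonneg _ _, ?_⟩
    change q.seminorm f ≤ _
    conv_lhs => rw [← AddMonoidAlgebra.sum_coeff_single f, Finsupp.sum]
    refine (Finset.le_sum_of_subadditive q.seminorm (map_zero _).le (map_add_le_add _) _ _).trans
      (Finset.sum_le_sum fun m _ => ?_)
    have : AddMonoidAlgebra.single m (f.coeff m) =
        algebraMap L A (f.coeff m) * AddMonoidAlgebra.single m 1 := by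
      rw [AddMonoidAlgebra.coe_algebraMap]
      refine Eq.trans ?_ (AddMonoidAlgebra.single_mul_single ..).symm
      simp
    rw [this, map_mul, q.extends_norm]
    exact mul_le_of_le_one_right (norm_nonneg _) (hq m)

end Chart

theorem TorusAn.seminorm_toChart_single {L : Type w} [NormedField L] {n : ℕ}
    (σ : PointedCone ℝ (Fin n → ℝ)) (p : TorusAn L n) (m : dualMonoid σ) :
    (p.toChart σ).seminorm (AddMonoidAlgebra.single m 1) =
      Real.exp (-(toReal m ⬝ᵥ p.val)) := by
  rw [← p.seminorm_single_one]
  change p.seminorm (AddMonoidAlgebra.mapDomainAlgHom L L (dualMonoid σ).subtype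
    (AddMonoidAlgebra.single m 1)) = _
  simp

/-! ### Metric functions stay close to the support function -/

namespace ToricMetric

variable {L : Type w} [NormedField L] {n : ℕ} {X : Fan n} {Ψ : (Fin n → ℝ) → ℝ}

theorem metricFunction_val (h : ToricMetric L X Ψ) (p : TorusAn L n) :
    h.metricFunction p.val = Real.log (h.normSec p) := by
  have hu : ∃ q : TorusAn L n, q.val = p.val := ⟨p, rfl⟩
  rw [metricFunction, dif_pos hu, h.invariant _ p hu.choose_spec]

/-- A point with valuation in `σ` lands in the compact part of the chart of `σ`, where the logarithm
of the norm of the local frame is continuous, hence bounded. Finitely many cones cover everything.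
-/
theorem exists_abs_log_normSec_sub_le (h : ToricMetric L X Ψ) (hX : X.IsComplete)
    (hΨ : X.IsVirtualSupport Ψ) :
    ∃ C : ℝ, ∀ p : TorusAn L n, |Real.log (h.normSec p) - Ψ p.val| ≤ C := by
  have hσ : ∀ σ ∈ X.cones, ∃ C : ℝ, ∀ p : TorusAn L n, p.val ∈ σ →
      |Real.log (h.normSec p) - Ψ p.val| ≤ C := by
    intro σ hσ
    obtain ⟨m, hm⟩ := hΨ σ hσ
    obtain ⟨g, hg, hpos, hgp⟩ := h.extends_to_chart σ hσ m hm
    obtain ⟨C, hC⟩ := (AnPoint.isCompact_bounded (L := L)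
      (S := dualMonoid σ)).exists_bound_of_continuousOn (f := fun q => Real.log (g q))
      (hg.log fun q => (hpos q).ne').continuousOn
    refine ⟨C, fun p hp => ?_⟩
    have hmem : ∀ k : dualMonoid σ,
        (p.toChart σ).seminorm (AddMonoidAlgebra.single k 1) ≤ 1 := by
      intro k
      rw [TorusAn.seminorm_toChart_single, Real.exp_le_one_iff, neg_nonpos]
      exact k.2 _ hp
    have := hC _ hmem
    rw [hgp, Real.log_mul (h.normSec_pos p).ne' (Real.exp_pos _).ne', Real.log_exp,
      Real.norm_eq_abs] at this
    rwa [hm _ hp]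
  choose! C hC using hσ
  obtain ⟨B, hB⟩ := (X.finite.image C).bddAbove
  refine ⟨B, fun p => ?_⟩
  obtain ⟨σ, hσ, hp⟩ := hX p.val
  exact (hC σ hσ p hp).trans (hB ⟨σ, hσ, rfl⟩)

end ToricMetric

/-! ### Sizes of families of sections -/

namespace SectionFamily

variable {L : Type w} [NormedField L] {n : ℕ} {Ψ : (Fin n → ℝ) → ℝ} (s : SectionFamily L Ψ)

theorem le_size (p : TorusAn L n) (j : Fin (s.len + 1)) :
    s.scale j * p.seminorm (s.sec j) ≤ s.size p :=
  le_ciSup (f := fun j => s.scale j * p.seminorm (s.sec j)) (Set.finite_range _).bddAbove j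

theorem exists_eq_size (p : TorusAn L n) :
    ∃ j, s.size p = s.scale j * p.seminorm (s.sec j) := by
  obtain ⟨j, hj⟩ := exists_eq_ciSup_of_finite (f := fun j => s.scale j * p.seminorm (s.sec j))
  exact ⟨j, hj.symm⟩

theorem size_pos (p : TorusAn L n) : 0 < s.size p := by
  obtain ⟨j, hj⟩ := s.noCommonZero p
  refine lt_of_lt_of_le (mul_pos (s.scale_pos j) ?_) (s.le_size p j)
  exact lt_of_le_of_ne (apply_nonneg _ _) hj.symm

/-- At Gauss points the logarithm of the size is a maximum of functions affine in the valuation, one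
per monomial. The proof takes the one active at the intermediate point, which is a lower bound
everywhere. -/
theorem convexOn_log_size_gaussPoint [IsUltrametricDist L] :
    ConvexOn ℝ Set.univ fun u => Real.log (s.size (TorusAn.gaussPoint u : TorusAn L n)) := by
  refine ⟨convex_univ, fun x _ y _ a b ha hb hab => ?_⟩
  have key : ∀ (j : Fin (s.len + 1)) (m : Fin n → ℤ) (u : Fin n → ℝ),
      s.scale j * (‖(s.sec j).coeff m‖ * Real.exp (-(toReal m ⬝ᵥ u))) ≤
        s.size (TorusAn.gaussPoint u : TorusAn L n) := by
    intro j m u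
    refine le_trans ?_ (s.le_size _ j)
    refine mul_le_mul_of_nonneg_left ?_ (s.scale_pos j).le
    rw [TorusAn.gaussPoint_seminorm]
    have := le_gaussSup
      (fun m : Fin n → ℤ => Real.toNNReal (Real.exp (-(toReal m ⬝ᵥ u)))) (s.sec j) m
    have h2 : ((‖(s.sec j).coeff m‖₊ * Real.toNNReal (Real.exp (-(toReal m ⬝ᵥ u))) : NNReal) : ℝ)
        ≤ _ := NNReal.coe_le_coe.mpr this
    rwa [NNReal.coe_mul, Real.coe_toNNReal _ (Real.exp_pos _).le, coe_nnnorm] at h2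
  set w := a • x + b • y with hw
  obtain ⟨j, hj⟩ := s.exists_eq_size (TorusAn.gaussPoint w : TorusAn L n)
  have hpos := s.size_pos (TorusAn.gaussPoint w : TorusAn L n)
  obtain ⟨m, hm⟩ : ∃ m, (TorusAn.gaussPoint w : TorusAn L n).seminorm (s.sec j) =
      ‖(s.sec j).coeff m‖ * Real.exp (-(toReal m ⬝ᵥ w)) := by
    have hne : (s.sec j).coeff.support.Nonempty := by
      by_contra h
      rw [Finset.not_nonempty_iff_eq_empty, Finsupp.support_eq_empty,
        AddMonoidAlgebra.coeff_eq_zero] at h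
      rw [hj, h, map_zero, mul_zero] at hpos
      exact lt_irrefl _ hpos
    obtain ⟨m, -, hm⟩ := Finset.exists_mem_eq_sup _ hne fun m =>
      ‖(s.sec j).coeff m‖₊ * Real.toNNReal (Real.exp (-(toReal m ⬝ᵥ w)))
    refine ⟨m, ?_⟩
    rw [TorusAn.gaussPoint_seminorm, gaussSup, hm, NNReal.coe_mul,
      Real.coe_toNNReal _ (Real.exp_pos _).le, coe_nnnorm]
  have hc : 0 < s.scale j * ‖(s.sec j).coeff m‖ := by
    rw [hj, hm, ← mul_assoc] at hpos
    exact (mul_pos_iff_of_pos_right (Real.exp_pos _)).mp hpos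
  have hlog : ∀ u, Real.log (s.scale j * (‖(s.sec j).coeff m‖ * Real.exp (-(toReal m ⬝ᵥ u)))) =
      Real.log (s.scale j * ‖(s.sec j).coeff m‖) - toReal m ⬝ᵥ u := by
    intro u
    rw [← mul_assoc, Real.log_mul hc.ne' (Real.exp_pos _).ne', Real.log_exp]; ring
  have hle : ∀ u, Real.log (s.scale j * ‖(s.sec j).coeff m‖) - toReal m ⬝ᵥ u ≤
      Real.log (s.size (TorusAn.gaussPoint u : TorusAn L n)) := by
    intro u
    rw [← hlog]
    refine Real.log_le_log ?_ (key j m u)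
    rw [← mul_assoc]
    exact mul_pos hc (Real.exp_pos _)
  change Real.log (s.size (TorusAn.gaussPoint w : TorusAn L n)) ≤ _
  rw [hj, hm, hlog, hw, dotProduct_add, dotProduct_smul, dotProduct_smul]
  have h1 := mul_le_mul_of_nonneg_left (hle x) ha
  have h2 := mul_le_mul_of_nonneg_left (hle y) hb
  simp only [smul_eq_mul] at *
  have h3 : b = 1 - a := by linarith
  subst h3
  linarith

theorem size_le_sum (p : TorusAn L n) :
    s.size p ≤ ∑ j, s.scale j *
      ∑ m ∈ (s.sec j).coeff.support, ‖(s.sec j).coeff m‖ * Real.exp (-(toReal m ⬝ᵥ p.val)) := by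
  refine ciSup_le fun j => ?_
  refine le_trans ?_ (Finset.single_le_sum (f := fun j => s.scale j *
      ∑ m ∈ (s.sec j).coeff.support, ‖(s.sec j).coeff m‖ * Real.exp (-(toReal m ⬝ᵥ p.val)))
      (fun j _ => mul_nonneg (s.scale_pos j).le
        (Finset.sum_nonneg fun m _ => mul_nonneg (norm_nonneg _) (Real.exp_pos _).le))
      (Finset.mem_univ j))
  exact mul_le_mul_of_nonneg_left (p.seminorm_le_sum _) (s.scale_pos j).le

end SectionFamily

/-! ## A three lines theorem for weighted sums of logarithms -/

/-- Dividing by `N` kills an error that stays bounded. This serves both for rounding real exponents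
and for asymptotics along rays. -/
theorem le_of_forall_nat_mul_le {X Y C : ℝ} (h : ∀ N : ℕ, N * X ≤ N * Y + C) : X ≤ Y := by
  by_contra! hlt
  obtain ⟨N, hN⟩ := exists_nat_gt (C / (X - Y))
  rw [div_lt_iff₀ (sub_pos.mpr hlt)] at hN
  linarith [h N]

open Complex.HadamardThreeLines in
-- The product of the `h i` to the real powers `α i` need not be holomorphic. The three lines
-- theorem is applied to the powers `⌈N α i⌉` instead, with rounding errors bounded independently of
-- `N`.
theorem sum_log_norm_le_of_strip {ι : Type*} [Fintype ι] {α : ι → ℝ} (hα : ∀ i, 0 < α i)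
    {h : ι → ℂ → ℂ} (hd : ∀ i, Differentiable ℂ (h i)) {S : ι → ℂ → ℝ} {A B C : ℝ}
    (hS : ∀ i z, ‖h i z‖ ≤ Real.exp (S i z))
    (hC : ∀ i z, z.re ∈ Set.Icc (0 : ℝ) 1 → S i z ≤ C)
    (hA : ∀ z : ℂ, z.re = 0 → ∑ i, α i * S i z ≤ A)
    (hB : ∀ z : ℂ, z.re = 1 → ∑ i, α i * S i z ≤ B)
    {t : ℝ} (ht : t ∈ Set.Icc (0 : ℝ) 1) (hne : ∀ i, h i t ≠ 0) :
    ∑ i, α i * Real.log ‖h i t‖ ≤ (1 - t) * A + t * B := by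
  -- The rounding factors lie in `[0, 1]`. Thus `D` bounds the excess on the edges, where `C` may be
  -- negative, and `E` bounds it at the interior point `t`.
  let D : ℝ := ∑ i : ι, max C 0
  let E : ℝ := ∑ i : ι, |Real.log ‖h i t‖|
  refine le_of_forall_nat_mul_le (C := D + E) fun N => ?_
  let k : ι → ℕ := fun i => ⌈N * α i⌉₊
  have hk0 : ∀ i, (0 : ℝ) ≤ k i - N * α i := fun i => sub_nonneg.mpr (Nat.le_ceil _)
  have hk1 : ∀ i, (k i : ℝ) - N * α i ≤ 1 := fun i => by
    have := Nat.ceil_lt_add_one (mul_nonneg (Nat.cast_nonneg N) (hα i).le)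
    linarith
  have hprod : ∀ z, ‖∏ i, h i z ^ k i‖ ≤ Real.exp (∑ i, k i * S i z) := by
    intro z
    rw [norm_prod, Real.exp_sum]
    refine Finset.prod_le_prod (fun i _ => norm_nonneg _) fun i _ => ?_
    rw [norm_pow, Real.exp_nat_mul]
    exact pow_le_pow_left₀ (norm_nonneg _) (hS i z) _
  have hedge : ∀ {z : ℂ} {R : ℝ}, z.re ∈ Set.Icc (0 : ℝ) 1 → ∑ i, α i * S i z ≤ R →
      ∑ i, k i * S i z ≤ N * R + D := by
    intro z R hz hR
    calc ∑ i, k i * S i z = N * ∑ i, α i * S i z + ∑ i, (k i - N * α i) * S i z := by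
          rw [Finset.mul_sum, ← Finset.sum_add_distrib]
          exact Finset.sum_congr rfl fun i _ => by ring
      _ ≤ N * R + D := by
          refine add_le_add (mul_le_mul_of_nonneg_left hR (Nat.cast_nonneg N))
            (Finset.sum_le_sum fun i _ => ?_)
          calc (k i - N * α i) * S i z ≤ (k i - N * α i) * max C 0 :=
                mul_le_mul_of_nonneg_left ((hC i z hz).trans (le_max_left _ _)) (hk0 i)
            _ ≤ 1 * max C 0 := mul_le_mul_of_nonneg_right (hk1 i) (le_max_right _ _)
            _ = _ := one_mul _
  have hdiff : Differentiable ℂ fun z => ∏ i, h i z ^ k i := by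
    have : (fun z => ∏ i, h i z ^ k i) = ∏ i, fun z => h i z ^ k i := by
      funext z; simp
    rw [this]
    exact Differentiable.finsetProd fun i _ => (hd i).pow _
  have hmain := norm_le_interp_of_mem_verticalClosedStrip₀₁' (fun z => ∏ i, h i z ^ k i)
    (z := (t : ℂ)) (a := Real.exp (N * A + D)) (b := Real.exp (N * B + D))
    (by simpa [verticalClosedStrip] using ht) hdiff.diffContOnCl
    (by
      refine ⟨Real.exp (∑ i, k i * max C 0), ?_⟩
      rintro _ ⟨z, hz, rfl⟩
      refine (hprod z).trans (Real.exp_le_exp.mpr (Finset.sum_le_sum fun i _ => ?_))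
      exact mul_le_mul_of_nonneg_left ((hC i z hz).trans (le_max_left _ _)) (Nat.cast_nonneg _))
    (fun z hz => (hprod z).trans (Real.exp_le_exp.mpr
      (hedge (by simp [show z.re = 0 from hz]) (hA z hz))))
    (fun z hz => (hprod z).trans (Real.exp_le_exp.mpr
      (hedge (by simp [show z.re = 1 from hz]) (hB z hz))))
  rw [← Real.exp_mul, ← Real.exp_mul, ← Real.exp_add, Complex.ofReal_re] at hmain
  have hpos : 0 < ‖∏ i, h i (t : ℂ) ^ k i‖ :=
    norm_pos_iff.mpr (Finset.prod_ne_zero_iff.mpr fun i _ => pow_ne_zero _ (hne i))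
  have hlog := (Real.log_le_iff_le_exp hpos).mpr hmain
  rw [norm_prod, Real.log_prod fun i _ => by
    rw [norm_pow]; exact pow_ne_zero _ (norm_ne_zero_iff.mpr (hne i))] at hlog
  simp only [norm_pow, Real.log_pow] at hlog
  have hsum : N * ∑ i, α i * Real.log ‖h i t‖ ≤ ∑ i, k i * Real.log ‖h i t‖ + E := by
    rw [Finset.mul_sum, ← Finset.sum_add_distrib]
    refine Finset.sum_le_sum fun i _ => ?_
    have h1 : -((k i - N * α i) * Real.log ‖h i t‖) ≤ |Real.log ‖h i t‖| := by
      refine (neg_le_abs _).trans ?_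
      rw [abs_mul, abs_of_nonneg (hk0 i)]
      exact mul_le_of_le_one_left (abs_nonneg _) (hk1 i)
    linarith
  have : (N * A + D) * (1 - t) + (N * B + D) * t = N * ((1 - t) * A + t * B) + D := by ring
  linarith

/-! ## Concavity of metric functions -/

theorem concaveOn_of_forall_approx {E : Type*} [AddCommGroup E] [Module ℝ E] {f : E → ℝ}
    (h : ∀ x y : E, ∀ a b : ℝ, 0 ≤ a → 0 ≤ b → a + b = 1 → ∀ ε : ℝ, 0 < ε →
      a * f x + b * f y ≤ f (a • x + b • y) + 2 * ε) : ConcaveOn ℝ Set.univ f := by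
  refine ⟨convex_univ, fun x _ y _ a b ha hb hab => ?_⟩
  refine le_of_forall_pos_le_add fun ε hε => ?_
  have := h x y a b ha hb hab (ε / 2) (half_pos hε)
  simp only [smul_eq_mul]
  linarith

namespace ToricMetric

variable {L : Type w} [NormedField L] {n : ℕ} {X : Fan n} {Ψ : (Fin n → ℝ) → ℝ}

/-- Restricted to Gauss points, the Fubini–Study approximants are concave in the valuation, and
concavity passes to uniform limits. -/
theorem IsSemipositive.concaveOn_of_isUltrametricDist [IsUltrametricDist L]
    {h : ToricMetric L X Ψ} (hs : h.IsSemipositive) :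
    ConcaveOn ℝ Set.univ h.metricFunction := by
  refine concaveOn_of_forall_approx fun x y a b ha hb hab ε hε => ?_
  obtain ⟨r, α, E, s, hα, -, -, happ⟩ := hs ε hε
  have hconv : ConvexOn ℝ Set.univ fun u =>
      ∑ i, α i * Real.log ((s i).size (TorusAn.gaussPoint u : TorusAn L n)) := by
    refine ⟨convex_univ, fun u _ v _ a b ha hb hab => ?_⟩
    simp only [smul_eq_mul, Finset.mul_sum]
    rw [← Finset.sum_add_distrib]
    refine Finset.sum_le_sum fun i _ => ?_
    have := mul_le_mul_of_nonneg_left ((s i).convexOn_log_size_gaussPoint.2 (Set.mem_univ u)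
      (Set.mem_univ v) ha hb hab) (hα i).le
    simp only [smul_eq_mul] at this
    linarith
  have hval : ∀ u, |h.metricFunction u +
      ∑ i, α i * Real.log ((s i).size (TorusAn.gaussPoint u : TorusAn L n))| ≤ ε := by
    intro u
    have := happ (TorusAn.gaussPoint u)
    rw [← h.metricFunction_val, TorusAn.gaussPoint_val] at this
    simpa [Finset.sum_neg_distrib] using this
  have hc := hconv.2 (Set.mem_univ x) (Set.mem_univ y) ha hb hab
  simp only [smul_eq_mul] at hc
  have h1 := mul_le_mul_of_nonneg_left (abs_le.mp (hval x)).2 ha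
  have h2 := mul_le_mul_of_nonneg_left (abs_le.mp (hval y)).2 hb
  have h3 := (abs_le.mp (hval (a • x + b • y))).1
  have h4 : a * ε + b * ε = ε := by rw [← add_mul, hab, one_mul]
  linarith

/-- The segment from `x` to `y` extends to a holomorphic curve in the complex torus whose valuation
depends only on the real part of the parameter. Concavity along it is a three lines inequality. -/
theorem IsSemipositive.concaveOn_of_ringHom_complex {ι : L →+* ℂ} (hι : ∀ x, ‖ι x‖ = ‖x‖)
    {h : ToricMetric L X Ψ} (hs : h.IsSemipositive) :
    ConcaveOn ℝ Set.univ h.metricFunction := by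
  refine concaveOn_of_forall_approx fun x y a b ha hb hab ε hε => ?_
  obtain ⟨r, α, E, s, hα, -, -, happ⟩ := hs ε hε
  let ζ : ℂ → Fin n → ℂ := fun z i => x i + z * ((y i - x i : ℝ) : ℂ)
  let P : ℂ → TorusAn L n := fun z => TorusAn.complexPoint (ζ z) hι
  have hP : ∀ z, (P z).val = x + z.re • (y - x) := by
    intro z
    rw [TorusAn.complexPoint_val]
    funext i
    simp [ζ]
  have hval : ∀ z : ℂ, |h.metricFunction (x + z.re • (y - x)) +
      ∑ i, α i * Real.log ((s i).size (P z))| ≤ ε := by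
    intro z
    have := happ (P z)
    rw [← h.metricFunction_val, hP] at this
    simpa [Finset.sum_neg_distrib] using this
  have hC : ∃ C : ℝ, ∀ i z, z.re ∈ Set.Icc (0 : ℝ) 1 → Real.log ((s i).size (P z)) ≤ C := by
    let φ : Fin r → ℝ → ℝ := fun i τ => ∑ j, (s i).scale j *
      ∑ m ∈ ((s i).sec j).coeff.support,
        ‖((s i).sec j).coeff m‖ * Real.exp (-(toReal m ⬝ᵥ (x + τ • (y - x))))
    have hφ : ∀ i, Continuous (φ i) := by
      intro i
      refine continuous_finsetSum _ fun j _ => continuous_const.mul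
        (continuous_finsetSum _ fun m _ => continuous_const.mul (Real.continuous_exp.comp ?_))
      simp only [dotProduct_add, dotProduct_smul, smul_eq_mul]
      fun_prop
    have : ∀ i, ∃ C : ℝ, ∀ τ ∈ Set.Icc (0 : ℝ) 1, φ i τ ≤ C := fun i => by
      obtain ⟨C, hC⟩ := (isCompact_Icc.image (hφ i)).bddAbove (α := ℝ)
      exact ⟨C, fun τ hτ => hC ⟨τ, hτ, rfl⟩⟩
    choose C hC using this
    obtain ⟨B, hB⟩ := (Set.finite_range C).bddAbove
    refine ⟨B, fun i z hz => ?_⟩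
    -- The crude estimate `log t ≤ t` suffices here, since only some uniform upper bound on the
    -- strip is needed.
    refine (Real.log_le_self ((s i).size_pos _).le).trans ?_
    refine ((s i).size_le_sum _).trans ?_
    rw [hP]
    exact (hC i _ hz).trans (hB ⟨i, rfl⟩)
  obtain ⟨C, hC⟩ := hC
  -- The section realizing the maximum at the intermediate point is kept fixed along the strip. It
  -- stays below the size everywhere and equals it at `b`.
  choose j hj using fun i => (s i).exists_eq_size (P (b : ℂ))
  let H : Fin r → ℂ → ℂ := fun i z =>
    ((s i).scale (j i) : ℂ) * TorusAn.evalExp ι (ζ z) ((s i).sec (j i))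
  have hHnorm : ∀ i z, ‖H i z‖ = (s i).scale (j i) * (P z).seminorm ((s i).sec (j i)) := by
    intro i z
    rw [norm_mul, Complex.norm_real, Real.norm_of_nonneg ((s i).scale_pos _).le]
    rfl
  have hb1 : b ∈ Set.Icc (0 : ℝ) 1 := ⟨hb, by linarith⟩
  have key := sum_log_norm_le_of_strip hα (h := H) (S := fun i z => Real.log ((s i).size (P z)))
    (A := ε - h.metricFunction x) (B := ε - h.metricFunction y) (C := C) (t := b)
    (fun i => by
      simp only [H, TorusAn.evalExp_eq_sum, ζ]
      fun_prop)
    (fun i z => by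
      rw [Real.exp_log ((s i).size_pos _), hHnorm]
      exact (s i).le_size _ _)
    hC
    (fun z hz => by
      have := (abs_le.mp (hval z)).2
      rw [hz, zero_smul, add_zero] at this
      linarith)
    (fun z hz => by
      have := (abs_le.mp (hval z)).2
      rw [hz, one_smul, add_sub_cancel] at this
      linarith)
    hb1
    (fun i => by
      rw [← norm_ne_zero_iff, hHnorm, ← hj]
      exact ((s i).size_pos _).ne')
  simp only [hHnorm, ← hj] at key
  have h3 := (abs_le.mp (hval (b : ℂ))).1
  have hab' : 1 - b = a := by linarith
  have hw : x + b • (y - x) = a • x + b • y := by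
    rw [← hab']
    module
  rw [Complex.ofReal_re, hw] at h3
  rw [hab'] at key
  have h4 : a * ε + b * ε = ε := by rw [← add_mul, hab, one_mul]
  linarith

end ToricMetric

/-! ### Metric functions of a divisor at the places -/

namespace Place

variable {K₀ : Type u} [Field K₀] {b : BaseField K₀} {K : Type w} [Field K] [Algebra K₀ K]

/-- Surjectivity of the valuation map ensures that the default value in `ToricMetric.metricFunction`
is never used. -/
theorem exists_val_eq (v : Place b K) {n : ℕ} (u : Fin n → ℝ) :
    ∃ p : TorusAn v.Completed n, p.val = u := by
  rcases v.isUltrametricDist_or with h | ⟨ι, hι⟩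
  · exact ⟨TorusAn.gaussPoint u, TorusAn.gaussPoint_val u⟩
  · exact ⟨TorusAn.complexPoint (fun i => (u i : ℂ)) hι, by
      rw [TorusAn.complexPoint_val]; simp⟩

end Place

namespace ToricMetrizedDivisor

variable {K₀ : Type u} [Field K₀] {b : BaseField K₀} {K : Type w} [Field K] [Algebra K₀ K] {n : ℕ}
  (D : ToricMetrizedDivisor b K n)

variable {D} in
theorem IsSemipositive.concaveOn_ψ (hD : D.IsSemipositive) (v : Place b K) :
    ConcaveOn ℝ Set.univ (D.ψ v) := by
  rcases v.isUltrametricDist_or with h | ⟨ι, hι⟩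
  · exact (hD v).concaveOn_of_isUltrametricDist
  · exact (hD v).concaveOn_of_ringHom_complex hι

theorem exists_abs_ψ_sub_supp_le (v : Place b K) :
    ∃ C : ℝ, ∀ u, |D.ψ v u - D.supp u| ≤ C := by
  obtain ⟨C, hC⟩ := (D.metric v).exists_abs_log_normSec_sub_le D.complete D.isSupport
  refine ⟨C, fun u => ?_⟩
  obtain ⟨p, rfl⟩ := v.exists_val_eq u
  rw [ψ, ToricMetric.metricFunction_val]
  exact hC p

theorem finite_ψ_ne_supp : {v : Place b K | D.ψ v ≠ D.supp}.Finite := by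
  refine D.quasiAlgebraic.subset fun v hv hcan => hv ?_
  funext u
  obtain ⟨p, rfl⟩ := v.exists_val_eq u
  rw [ψ, ToricMetric.metricFunction_val, hcan]

theorem supp_smul {t : ℝ} (ht : 0 ≤ t) (u : Fin n → ℝ) : D.supp (t • u) = t * D.supp u := by
  obtain ⟨σ, hσ, hu⟩ := D.complete u
  obtain ⟨m, hm⟩ := D.isSupport σ hσ
  have htu : t • u ∈ σ := Submodule.smul_mem σ (⟨t, ht⟩ : {c : ℝ // 0 ≤ c}) hu
  rw [hm _ hu, hm _ htu, dotProduct_smul, smul_eq_mul]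

end ToricMetrizedDivisor

/-! ## Concave duality -/

section Duality

variable {n : ℕ}

/-- The concave Legendre-Fenchel dual. -/
def concaveDual (ψ : (Fin n → ℝ) → ℝ) (x : Fin n → ℝ) : ℝ := ⨅ u : Fin n → ℝ, x ⬝ᵥ u - ψ u

/-- Hahn–Banach separates the graph point over `u₀` from the open strict hypograph. The vertical
component `s` of the functional is positive, so dividing by it gives a slope. -/
theorem exists_supergradient {ψ : (Fin n → ℝ) → ℝ} (hψ : ConcaveOn ℝ Set.univ ψ)
    (u₀ : Fin n → ℝ) : ∃ z : Fin n → ℝ, ∀ u, ψ u ≤ ψ u₀ + z ⬝ᵥ (u - u₀) := by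
  have hcont : Continuous ψ := continuousOn_univ.mp (hψ.continuousOn isOpen_univ)
  have hconv : Convex ℝ {p : (Fin n → ℝ) × ℝ | p.2 < ψ p.1} := by
    have := hψ.convex_strict_hypograph
    simpa using this
  have hopen : IsOpen {p : (Fin n → ℝ) × ℝ | p.2 < ψ p.1} :=
    isOpen_lt continuous_snd (hcont.comp continuous_fst)
  obtain ⟨f, hf⟩ := geometric_hahn_banach_open_point hconv hopen
    (x := (u₀, ψ u₀)) (by simp)
  set s : ℝ := f (0, 1) with hs
  set ℓ : (Fin n → ℝ) →ₗ[ℝ] ℝ := f.toLinearMap.comp (LinearMap.inl ℝ (Fin n → ℝ) ℝ) with hℓ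
  have hfs : ∀ u t, f (u, t) = ℓ u + t * s := by
    intro u t
    have : (u, t) = (u, (0 : ℝ)) + t • ((0 : Fin n → ℝ), (1 : ℝ)) := by simp
    rw [this, map_add, map_smul]
    rfl
  have hspos : 0 < s := by
    have := hf (u₀, ψ u₀ - 1) (by simp)
    rw [hfs, hfs] at this
    linarith
  have hle : ∀ u, ℓ u + ψ u * s ≤ ℓ u₀ + ψ u₀ * s := by
    intro u
    refine le_of_forall_pos_le_add fun ε hε => ?_
    have := hf (u, ψ u - ε / s) (by simp only [Set.mem_ofPred_eq]; linarith [div_pos hε hspos])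
    rw [hfs, hfs, sub_mul, div_mul_cancel₀ _ hspos.ne'] at this
    linarith
  have hdot : ∀ u, ℓ u = (fun i => ℓ (Pi.single i 1)) ⬝ᵥ u := by
    intro u
    rw [LinearMap.pi_apply_eq_sum_univ ℓ u, dotProduct]
    refine Finset.sum_congr rfl fun i _ => ?_
    rw [smul_eq_mul, mul_comm]
    congr 2
    funext j
    simp [Pi.single_apply, eq_comm]
  refine ⟨(-s⁻¹) • fun i => ℓ (Pi.single i 1), fun u => ?_⟩
  rw [smul_dotProduct, dotProduct_sub, ← hdot, ← hdot, smul_eq_mul]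
  have := hle u
  have h2 : s * (ψ u₀ + -s⁻¹ * (ℓ u - ℓ u₀)) = s * ψ u₀ - (ℓ u - ℓ u₀) := by
    field_simp
    ring
  refine le_of_mul_le_mul_left ?_ hspos
  rw [h2]
  linarith

/-- A concave function at bounded distance from the support function `Ψ`. -/
structure IsMetricFunction (Ψ ψ : (Fin n → ℝ) → ℝ) : Prop where
  concaveOn : ConcaveOn ℝ Set.univ ψ
  bounded : ∃ C : ℝ, ∀ u, |ψ u - Ψ u| ≤ C

theorem convex_supDifferential (C : Set (Fin n → ℝ)) (g : (Fin n → ℝ) → ℝ) (x : Fin n → ℝ) :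
    Convex ℝ (supDifferential C g x) := by
  intro u hu v hv a b ha hb hab z hz
  have h1 := mul_le_mul_of_nonneg_left (hu z hz) ha
  have h2 := mul_le_mul_of_nonneg_left (hv z hz) hb
  rw [dotProduct_add, dotProduct_smul, dotProduct_smul, smul_eq_mul, smul_eq_mul]
  have : a * (g z - g x) + b * (g z - g x) = g z - g x := by rw [← add_mul, hab, one_mul]
  linarith

theorem isClosed_supDifferential (C : Set (Fin n → ℝ)) (g : (Fin n → ℝ) → ℝ) (x : Fin n → ℝ) :
    IsClosed (supDifferential C g x) := by
  have : supDifferential C g x = ⋂ z ∈ C, {u | g z - g x ≤ (z - x) ⬝ᵥ u} := by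
    ext u; simp [supDifferential]
  rw [this]
  refine isClosed_biInter fun z _ => isClosed_le continuous_const ?_
  exact continuous_const.dotProduct continuous_id

variable {Ψ ψ : (Fin n → ℝ) → ℝ}

namespace IsMetricFunction

theorem continuous (h : IsMetricFunction Ψ ψ) : Continuous ψ :=
  continuousOn_univ.mp (h.concaveOn.continuousOn isOpen_univ)

theorem bddBelow (h : IsMetricFunction Ψ ψ) {x : Fin n → ℝ} (hx : x ∈ polytope Ψ) :
    BddBelow (Set.range fun u => x ⬝ᵥ u - ψ u) := by
  obtain ⟨C, hC⟩ := h.bounded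
  refine ⟨-C, ?_⟩
  rintro _ ⟨u, rfl⟩
  have := (abs_le.mp (hC u)).2
  have := hx u
  simp only
  linarith

theorem concaveDual_le (h : IsMetricFunction Ψ ψ) {x : Fin n → ℝ} (hx : x ∈ polytope Ψ)
    (u : Fin n → ℝ) : concaveDual ψ x ≤ x ⬝ᵥ u - ψ u :=
  ciInf_le (h.bddBelow hx) u

/-- Along the ray of multiples `N • u`, the bounded difference between `ψ` and the homogeneous `Ψ`
becomes negligible. -/
theorem mem_polytope_of_supergradient (h : IsMetricFunction Ψ ψ)
    (hΨ : ∀ t : ℝ, 0 ≤ t → ∀ u, Ψ (t • u) = t * Ψ u) {z u₀ : Fin n → ℝ}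
    (hz : ∀ u, ψ u ≤ ψ u₀ + z ⬝ᵥ (u - u₀)) : z ∈ polytope Ψ := by
  obtain ⟨C, hC⟩ := h.bounded
  intro u
  refine le_of_forall_nat_mul_le (C := C + ψ u₀ - z ⬝ᵥ u₀) fun N => ?_
  have h1 := hz ((N : ℝ) • u)
  have h2 := (abs_le.mp (hC ((N : ℝ) • u))).1
  rw [hΨ _ (Nat.cast_nonneg N)] at h2
  rw [dotProduct_sub, dotProduct_smul, smul_eq_mul] at h1
  linarith

theorem concaveDual_eq_of_supergradient (h : IsMetricFunction Ψ ψ)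
    (hΨ : ∀ t : ℝ, 0 ≤ t → ∀ u, Ψ (t • u) = t * Ψ u) {z u₀ : Fin n → ℝ}
    (hz : ∀ u, ψ u ≤ ψ u₀ + z ⬝ᵥ (u - u₀)) : concaveDual ψ z = z ⬝ᵥ u₀ - ψ u₀ := by
  refine le_antisymm (h.concaveDual_le (h.mem_polytope_of_supergradient hΨ hz) u₀)
    (le_ciInf fun u => ?_)
  have := hz u
  rw [dotProduct_sub] at this
  linarith

/-- The sup-differential of the dual is the contact set. -/
theorem mem_supDifferential_iff (h : IsMetricFunction Ψ ψ)
    (hΨ : ∀ t : ℝ, 0 ≤ t → ∀ u, Ψ (t • u) = t * Ψ u) {x : Fin n → ℝ} (hx : x ∈ polytope Ψ)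
    (u : Fin n → ℝ) :
    u ∈ supDifferential (polytope Ψ) (concaveDual ψ) x ↔ ψ u = x ⬝ᵥ u - concaveDual ψ x := by
  constructor
  · intro hu
    -- A supergradient `z` of `ψ` at `u` lies in the polytope and computes the dual there. Testing
    -- the sup-differential at `z` yields the missing inequality.
    obtain ⟨z, hz⟩ := exists_supergradient h.concaveOn u
    have h1 := hu z (h.mem_polytope_of_supergradient hΨ hz)
    rw [h.concaveDual_eq_of_supergradient hΨ hz, sub_dotProduct] at h1
    have h2 := h.concaveDual_le hx u
    linarith
  · intro hu z hz
    have := h.concaveDual_le hz u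
    rw [sub_dotProduct]
    linarith

/-- Linear growth makes `ψ` integrable against every probability measure with finite first moment.
-/
theorem exists_abs_le (h : IsMetricFunction Ψ ψ)
    (hΨ : ∀ t : ℝ, 0 ≤ t → ∀ u, Ψ (t • u) = t * Ψ u) :
    ∃ A B : ℝ, ∀ u, |ψ u| ≤ A + B * ‖u‖ := by
  obtain ⟨C, hC⟩ := h.bounded
  obtain ⟨B, hB⟩ := (isCompact_closedBall (0 : Fin n → ℝ) 1).exists_bound_of_continuousOn
    h.continuous.continuousOn
  refine ⟨C, B + C, fun u => ?_⟩
  have hΨu : |Ψ u| ≤ (B + C) * ‖u‖ := by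
    by_cases hu : u = 0
    · have := hΨ 0 le_rfl u
      rw [zero_smul, zero_mul] at this
      rw [hu, this]; simp
    · have hn : 0 < ‖u‖ := norm_pos_iff.mpr hu
      have h1 : Ψ u = ‖u‖ * Ψ (‖u‖⁻¹ • u) := by
        rw [← hΨ _ hn.le, smul_smul, mul_inv_cancel₀ hn.ne', one_smul]
      have hmem : ‖u‖⁻¹ • u ∈ Metric.closedBall (0 : Fin n → ℝ) 1 := by
        rw [mem_closedBall_zero_iff, norm_smul, norm_inv, norm_norm, inv_mul_cancel₀ hn.ne']
      have h2 := hB _ hmem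
      have h3 := hC (‖u‖⁻¹ • u)
      rw [Real.norm_eq_abs] at h2
      have h4 : |Ψ (‖u‖⁻¹ • u)| ≤ B + C := by
        rw [abs_le] at *
        constructor <;> linarith
      rw [h1, abs_mul, abs_of_pos hn, mul_comm]
      exact mul_le_mul_of_nonneg_right h4 hn.le
  have := hC u
  rw [abs_le] at *
  constructor <;> linarith

end IsMetricFunction

/-- The infimum is reached at `u = 0`. Canonical places therefore contribute nothing to the roof
function. -/
theorem concaveDual_self (hΨ : ∀ t : ℝ, 0 ≤ t → ∀ u, Ψ (t • u) = t * Ψ u) {x : Fin n → ℝ}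
    (hx : x ∈ polytope Ψ) : concaveDual Ψ x = 0 := by
  have h0 : Ψ 0 = 0 := by simpa using hΨ 0 le_rfl 0
  refine le_antisymm ?_ (le_ciInf fun u => sub_nonneg.mpr (hx u))
  have : concaveDual Ψ x ≤ x ⬝ᵥ 0 - Ψ 0 := by
    refine ciInf_le ⟨0, ?_⟩ (0 : Fin n → ℝ)
    rintro _ ⟨u, rfl⟩
    exact sub_nonneg.mpr (hx u)
  simpa [h0] using this

theorem exists_ball_subset {s : Set (Fin n → ℝ)} (h : (interior s).Nonempty) :
    ∃ x₀, ∃ r > 0, ∀ z, ‖z‖ ≤ r → x₀ + z ∈ s := by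
  obtain ⟨x₀, hx₀⟩ := h
  obtain ⟨r, hr, hsub⟩ := Metric.isOpen_iff.mp isOpen_interior x₀ hx₀
  refine ⟨x₀, r / 2, half_pos hr, fun z hz => interior_subset (hsub ?_)⟩
  rw [Metric.mem_ball, dist_eq_norm, add_sub_cancel_left]
  linarith

theorem eq_zero_of_dotProduct_eq_zero {s : Set (Fin n → ℝ)} (h : (interior s).Nonempty)
    {x p : Fin n → ℝ} (hp : ∀ z ∈ s, (z - x) ⬝ᵥ p = 0) : p = 0 := by
  obtain ⟨x₀, r, hr, hs⟩ := exists_ball_subset h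
  have h1 := hp _ (hs 0 (by simpa using hr.le))
  have h2 := hp _ (hs ((r / (‖p‖ + 1)) • p) (by
    rw [norm_smul, Real.norm_of_nonneg (by positivity), div_mul_eq_mul_div, div_le_iff₀
      (by positivity)]
    nlinarith [norm_nonneg p]))
  have h3 : (r / (‖p‖ + 1)) * (p ⬝ᵥ p) = 0 := by
    rw [← smul_eq_mul, ← smul_dotProduct]
    simp only [sub_dotProduct, add_dotProduct, zero_dotProduct] at h1 h2
    linarith
  have h4 : r / (‖p‖ + 1) ≠ 0 := by positivity
  exact dotProduct_self_eq_zero.mp ((mul_eq_zero.mp h3).resolve_left h4)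

/-- Coercivity from bigness: a ball inside the polytope leaves a margin proportional to `‖u‖` below
a linear function. -/
theorem exists_support_le (h : (interior (polytope Ψ)).Nonempty) :
    ∃ x₀ : Fin n → ℝ, ∃ r > 0, ∀ u, Ψ u ≤ x₀ ⬝ᵥ u - r * ‖u‖ := by
  obtain ⟨x₀, r, hr, hs⟩ := exists_ball_subset h
  refine ⟨x₀, r, hr, fun u => ?_⟩
  have hx₀ : 0 ≤ x₀ ⬝ᵥ u - Ψ u := by
    have := hs 0 (by simpa using hr.le) u
    rw [add_zero] at this
    linarith
  have : ‖u‖ ≤ (x₀ ⬝ᵥ u - Ψ u) / r := by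
    refine (pi_norm_le_iff_of_nonneg (div_nonneg hx₀ hr.le)).mpr fun i => ?_
    rw [le_div_iff₀ hr, Real.norm_eq_abs]
    have hz : ∀ c : ℝ, |c| ≤ r → Ψ u ≤ x₀ ⬝ᵥ u + c * u i := by
      intro c hc
      have := hs (Pi.single i c) (by rwa [Pi.norm_single, Real.norm_eq_abs]) u
      rwa [add_dotProduct, single_dotProduct] at this
    -- The norm is the sup norm, so it is enough to move the center by `r` along one coordinate,
    -- against the sign of `u i`.
    rcases abs_cases (u i) with ⟨h1, -⟩ | ⟨h1, -⟩
    · have := hz (-r) (by rw [abs_neg, abs_of_pos hr])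
      rw [h1]; linarith
    · have := hz r (by rw [abs_of_pos hr])
      rw [h1]; linarith
  rw [le_div_iff₀ hr] at this
  linarith

theorem isCompact_polytope {B : ℝ} (hB : ∀ u, ‖u‖ ≤ 1 → |Ψ u| ≤ B) : IsCompact (polytope Ψ) := by
  have hcl : IsClosed (polytope Ψ) := by
    have : polytope Ψ = ⋂ u, {x | Ψ u ≤ x ⬝ᵥ u} := by ext; simp [polytope]
    rw [this]
    exact isClosed_iInter fun u => isClosed_le continuous_const
      (continuous_id.dotProduct continuous_const)
  refine Metric.isCompact_of_isClosed_isBounded hcl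
    ((Metric.isBounded_closedBall (x := (0 : Fin n → ℝ)) (r := B)).subset fun x hx => ?_)
  have hB' : ∀ (i : Fin n) (c : ℝ), |c| = 1 → -B ≤ c * x i := by
    intro i c hc
    have h1 := hB (Pi.single i c) (by rw [Pi.norm_single, Real.norm_eq_abs, hc])
    have h2 := hx (Pi.single i c)
    rw [dotProduct_single] at h2
    have := (abs_le.mp h1).1
    linarith
  have hB0 : 0 ≤ B := (abs_nonneg _).trans (hB 0 (by simp))
  rw [mem_closedBall_zero_iff, pi_norm_le_iff_of_nonneg hB0]
  intro i
  rw [Real.norm_eq_abs, abs_le]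
  have h1 := hB' i 1 (by simp)
  have h2 := hB' i (-1) (by simp)
  constructor <;> linarith

theorem IsMetricFunction.isCompact_polytope (h : IsMetricFunction Ψ ψ)
    (hΨ : ∀ t : ℝ, 0 ≤ t → ∀ u, Ψ (t • u) = t * Ψ u) : IsCompact (polytope Ψ) := by
  obtain ⟨A, B, hAB⟩ := h.exists_abs_le hΨ
  obtain ⟨C, hC⟩ := h.bounded
  refine ToricHeights.isCompact_polytope (B := A + |B| + C) fun u hu => ?_
  have h1 : B * ‖u‖ ≤ |B| :=
    (mul_le_mul_of_nonneg_right (le_abs_self B) (norm_nonneg u)).trans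
      (mul_le_of_le_one_right (abs_nonneg B) hu)
  have h2 := hAB u
  have h3 := hC u
  rw [abs_le] at h2 h3 ⊢
  constructor <;> linarith

theorem IsMetricFunction.upperSemicontinuousOn_concaveDual (h : IsMetricFunction Ψ ψ) :
    UpperSemicontinuousOn (concaveDual ψ) (polytope Ψ) :=
  upperSemicontinuousOn_ciInf (fun _ hx => h.bddBelow hx) fun _ =>
    ((continuous_id.dotProduct continuous_const).sub
      continuous_const).continuousOn.upperSemicontinuousOn

end Duality

/-! ## The sum rule for sup-differentials -/

section SumRule

variable {n : ℕ} {ι : Type*} [Fintype ι] {Ψ : (Fin n → ℝ) → ℝ} {ψ : ι → (Fin n → ℝ) → ℝ}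
  {c : ι → ℝ}

/-- The supremum defining the sup-convolution of the `ψ i` is attained, because coercivity makes the
relevant superlevel sets compact. -/
theorem exists_isMax_sum [Nonempty ι] (hψ : ∀ i, IsMetricFunction Ψ (ψ i)) (hc : ∀ i, 0 < c i)
    (hint : (interior (polytope Ψ)).Nonempty) (y : Fin n → ℝ) :
    ∃ u : ι → Fin n → ℝ, ∑ i, c i • u i = y ∧
      ∀ u' : ι → Fin n → ℝ, ∑ i, c i • u' i = y →
        ∑ i, c i * ψ i (u' i) ≤ ∑ i, c i * ψ i (u i) := by
  classical
  obtain ⟨x₀, r, hr, hΨ⟩ := exists_support_le hint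
  choose C hC using fun i => (hψ i).bounded
  obtain ⟨i₀⟩ := ‹Nonempty ι›
  let f : (ι → Fin n → ℝ) → ℝ := fun u => ∑ i, c i * ψ i (u i)
  have hf : Continuous f := continuous_finsetSum _ fun i _ =>
    continuous_const.mul ((hψ i).continuous.comp (continuous_apply i))
  -- Putting all of `y` in one component gives a first decomposition, whose value cuts out the
  -- superlevel set `K`.
  let u₀ : ι → Fin n → ℝ := Pi.single i₀ ((c i₀)⁻¹ • y)
  have hu₀ : ∑ i, c i • u₀ i = y := by
    rw [Finset.sum_eq_single i₀]
    · simp [u₀, smul_smul, mul_inv_cancel₀ (hc i₀).ne']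
    · intro i _ hi
      simp [u₀, hi]
    · simp
  let K : Set (ι → Fin n → ℝ) := {u | ∑ i, c i • u i = y ∧ f u₀ ≤ f u}
  have hKcl : IsClosed K := by
    refine (isClosed_eq ?_ continuous_const).inter (isClosed_le continuous_const hf)
    exact continuous_finsetSum _ fun i _ => (continuous_apply i).const_smul (c i)
  let R : ℝ := ∑ i, c i * C i + x₀ ⬝ᵥ y - f u₀
  have hKb : ∀ u ∈ K, ∀ i, ‖u i‖ ≤ R / (c i * r) := by
    rintro u ⟨huy, hfu⟩ i
    rw [le_div_iff₀ (mul_pos (hc i) hr)]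
    have h1 : ∀ j, c j * ψ j (u j) ≤
        c j * C j + x₀ ⬝ᵥ (c j • u j) - ‖u j‖ * (c j * r) := by
      intro j
      have h2 := (abs_le.mp (hC j (u j))).2
      have h3 := hΨ (u j)
      have := mul_le_mul_of_nonneg_left
        (show ψ j (u j) ≤ C j + (x₀ ⬝ᵥ u j - r * ‖u j‖) by linarith) (hc j).le
      rw [dotProduct_smul, smul_eq_mul]
      linarith
    have h4 : f u ≤ ∑ i, c i * C i + x₀ ⬝ᵥ y - ∑ j, ‖u j‖ * (c j * r) := by
      rw [← huy, dotProduct_sum, ← Finset.sum_add_distrib, ← Finset.sum_sub_distrib]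
      exact Finset.sum_le_sum fun j _ => h1 j
    have h5 : ‖u i‖ * (c i * r) ≤ ∑ j, ‖u j‖ * (c j * r) :=
      Finset.single_le_sum (f := fun j => ‖u j‖ * (c j * r))
        (fun j _ => mul_nonneg (norm_nonneg _) (mul_pos (hc j) hr).le) (Finset.mem_univ i)
    simp only [R]
    linarith
  have hK : IsCompact K := by
    refine IsCompact.of_isClosed_subset (isCompact_univ_pi fun i =>
      isCompact_closedBall (0 : Fin n → ℝ) (R / (c i * r))) hKcl fun u hu i _ => ?_
    rw [mem_closedBall_zero_iff]
    exact hKb u hu i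
  obtain ⟨u, hu, hmax⟩ := hK.exists_isMaxOn ⟨u₀, hu₀, le_rfl⟩ hf.continuousOn
  refine ⟨u, hu.1, fun u' hu' => ?_⟩
  by_cases h : f u₀ ≤ f u'
  · exact hmax (⟨hu', h⟩ : u' ∈ K)
  · exact (not_le.mp h).le.trans hu.2

/-- The optimal decomposition of `y` in the sup-convolution works for every `x` with `y` in the
sup-differential. The sup-convolution `φ` is concave, and its supergradient at `y` is a common
supergradient of all the `ψ i` at the components. -/
theorem exists_decomposition_of_mem_supDifferential_sum [Nonempty ι]
    (hψ : ∀ i, IsMetricFunction Ψ (ψ i)) (hc : ∀ i, 0 < c i)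
    (hΨ : ∀ t : ℝ, 0 ≤ t → ∀ u, Ψ (t • u) = t * Ψ u)
    (hint : (interior (polytope Ψ)).Nonempty) {x y : Fin n → ℝ} (hx : x ∈ polytope Ψ)
    (hy : y ∈ supDifferential (polytope Ψ) (fun x => ∑ i, c i * concaveDual (ψ i) x) x) :
    ∃ u : ι → Fin n → ℝ, ∑ i, c i • u i = y ∧
      ∀ i, u i ∈ supDifferential (polytope Ψ) (concaveDual (ψ i)) x := by
  classical
  choose U hU hUmax using exists_isMax_sum hψ hc hint
  let φ : (Fin n → ℝ) → ℝ := fun y => ∑ i, c i * ψ i (U y i)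
  have hφ : ConcaveOn ℝ Set.univ φ := by
    refine ⟨convex_univ, fun y₁ _ y₂ _ a b ha hb hab => ?_⟩
    have h1 := hUmax (a • y₁ + b • y₂) (a • U y₁ + b • U y₂) (by
      conv_rhs => rw [← hU y₁, ← hU y₂]
      rw [Finset.smul_sum, Finset.smul_sum, ← Finset.sum_add_distrib]
      refine Finset.sum_congr rfl fun i _ => ?_
      simp only [Pi.add_apply, Pi.smul_apply, smul_add]
      rw [smul_comm, smul_comm (c i) b])
    refine le_trans ?_ h1
    simp only [φ, smul_eq_mul, Finset.mul_sum]
    rw [← Finset.sum_add_distrib]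
    refine Finset.sum_le_sum fun i _ => ?_
    have := mul_le_mul_of_nonneg_left ((hψ i).concaveOn.2 (Set.mem_univ (U y₁ i))
      (Set.mem_univ (U y₂ i)) ha hb hab) (hc i).le
    simp only [smul_eq_mul, Pi.add_apply, Pi.smul_apply] at this ⊢
    linarith
  obtain ⟨z, hz⟩ := exists_supergradient hφ y
  -- Only the `i`-th component is changed and the total is allowed to move with it, which turns the
  -- supergradient inequality for `φ` into one for `ψ i`.
  have hzi : ∀ i u, ψ i u ≤ ψ i (U y i) + z ⬝ᵥ (u - U y i) := by
    intro i u
    have h1 := hUmax (∑ j, c j • Function.update (U y) i u j) (Function.update (U y) i u) rfl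
    have h2 := h1.trans (hz _)
    have e1 : ∑ j, c j * ψ j (Function.update (U y) i u j) =
        φ y + c i * (ψ i u - ψ i (U y i)) := by
      have : ∀ j, c j * ψ j (Function.update (U y) i u j) =
          c j * ψ j (U y j) + if j = i then c i * (ψ i u - ψ i (U y i)) else 0 := by
        intro j
        by_cases h : j = i
        · subst h; simp; ring
        · simp [h]
      simp only [this, Finset.sum_add_distrib, Finset.sum_ite_eq', Finset.mem_univ, if_true, φ]
    have e2 : ∑ j, c j • Function.update (U y) i u j - y = c i • (u - U y i) := by
      have : ∀ j, c j • Function.update (U y) i u j =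
          c j • U y j + if j = i then c i • (u - U y i) else 0 := by
        intro j
        by_cases h : j = i
        · subst h; simp [smul_sub]
        · simp [h]
      simp only [this, Finset.sum_add_distrib, Finset.sum_ite_eq', Finset.mem_univ, if_true, hU]
      simp
    rw [e1, e2, dotProduct_smul, smul_eq_mul] at h2
    have h3 : c i * (ψ i u - ψ i (U y i)) ≤ c i * (z ⬝ᵥ (u - U y i)) := by linarith
    have := le_of_mul_le_mul_left h3 (hc i)
    linarith
  obtain ⟨i₀⟩ := ‹Nonempty ι›
  have hzΔ : z ∈ polytope Ψ := (hψ i₀).mem_polytope_of_supergradient hΨ (hzi i₀)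
  have hdual : ∀ i, concaveDual (ψ i) z = z ⬝ᵥ U y i - ψ i (U y i) := fun i =>
    (hψ i).concaveDual_eq_of_supergradient hΨ (hzi i)
  refine ⟨U y, hU y, fun i => ((hψ i).mem_supDifferential_iff hΨ hx _).mpr ?_⟩
  have hnn : ∀ i, 0 ≤ c i * (x ⬝ᵥ U y i - ψ i (U y i) - concaveDual (ψ i) x) := fun i =>
    mul_nonneg (hc i).le (sub_nonneg.mpr ((hψ i).concaveDual_le hx _))
  -- The hypothesis on `y`, tested at `z`, bounds the weighted sum of the nonnegative contact
  -- defects by zero. Each defect then vanishes.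
  have hsum : ∑ i, c i * (x ⬝ᵥ U y i - ψ i (U y i) - concaveDual (ψ i) x) = 0 := by
    refine le_antisymm ?_ (Finset.sum_nonneg fun i _ => hnn i)
    have h1 := hy z hzΔ
    have h2 : (z - x) ⬝ᵥ y = ∑ i, c i * (z ⬝ᵥ U y i - x ⬝ᵥ U y i) := by
      conv_lhs => rw [← hU y]
      rw [dotProduct_sum]
      refine Finset.sum_congr rfl fun i _ => ?_
      rw [dotProduct_smul, sub_dotProduct, smul_eq_mul]
    rw [h2] at h1
    simp only [hdual] at h1
    rw [← Finset.sum_sub_distrib] at h1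
    rw [← sub_nonneg, ← Finset.sum_sub_distrib] at h1
    rw [← neg_nonneg, ← Finset.sum_neg_distrib]
    refine h1.trans_eq (Finset.sum_congr rfl fun i _ => by ring)
  have := (Finset.sum_eq_zero_iff_of_nonneg fun i _ => hnn i).mp hsum i (Finset.mem_univ i)
  have := (mul_eq_zero.mp this).resolve_left (hc i).ne'
  linarith

end SumRule

/-! ## Roof functions and their sup-differentials -/

section Vertex

variable {E : Type*} [AddCommGroup E] [Module ℝ E]

theorem eq_zero_of_zero_mem_extremePoints {A : Set E} (h : 0 ∈ A.extremePoints ℝ) {p q : E}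
    (hp : p ∈ A) (hq : q ∈ A) {s t : ℝ} (hs : 0 < s) (ht : 0 < t) (hpq : s • p + t • q = 0) :
    p = 0 := by
  have hst : 0 < s + t := add_pos hs ht
  refine h.2 hp hq ⟨s / (s + t), t / (s + t), div_pos hs hst, div_pos ht hst, by
    rw [← add_div, div_self hst.ne'], ?_⟩
  rw [div_eq_inv_mul, div_eq_inv_mul, mul_smul, mul_smul, ← smul_add, hpq, smul_zero]

end Vertex

theorem isFace_singleton {n : ℕ} {E : Set (Fin n → ℝ)} {a : Fin n → ℝ}
    (h : a ∈ E.extremePoints ℝ) : IsFace E {a} :=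
  ⟨⟨a, rfl⟩, convex_singleton a, isExtreme_singleton.mpr h⟩

/-- A segment of `E` with `a` in its interior lies in every face containing `a`, hence in the
minimal face. -/
theorem mem_extremePoints_of_minimalFace_eq_singleton {n : ℕ} {E B : Set (Fin n → ℝ)}
    {a : Fin n → ℝ} (h : minimalFace E B = {a}) (ha : a ∈ E) : a ∈ E.extremePoints ℝ := by
  refine ⟨ha, fun p hp q hq hpq => ?_⟩
  have : p ∈ minimalFace E B := by
    rintro F ⟨hF, hBF⟩
    refine hF.2.2.left_mem_of_mem_openSegment hp hq ?_ hpq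
    have : a ∈ minimalFace E B := by rw [h]; rfl
    exact this F ⟨hF, hBF⟩
  rwa [h] at this

theorem subset_minimalFace {n : ℕ} (E B : Set (Fin n → ℝ)) : B ⊆ minimalFace E B :=
  fun _ ha _ hF => hF.2 ha

theorem minimalFace_eq_singleton {n : ℕ} {E : Set (Fin n → ℝ)} {a : Fin n → ℝ}
    (h : a ∈ E.extremePoints ℝ) : minimalFace E {a} = {a} :=
  Set.Subset.antisymm (fun _ hp => hp _ ⟨isFace_singleton h, le_rfl⟩) (subset_minimalFace _ _)

namespace ToricMetrizedDivisor

variable {K₀ : Type u} [Field K₀] {b : BaseField K₀} {K : Type w} [Field K] [Algebra K₀ K] {n : ℕ}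
  {D : ToricMetrizedDivisor b K n}

theorem isMetricFunction (hD : D.IsSemipositive) (v : Place b K) :
    IsMetricFunction D.supp (D.ψ v) :=
  ⟨hD.concaveOn_ψ v, D.exists_abs_ψ_sub_supp_le v⟩

theorem localRoof_eq_zero {v : Place b K} (hv : D.ψ v = D.supp) {x : Fin n → ℝ} (hx : x ∈ D.Δ) :
    D.localRoof v x = 0 := by
  have := concaveDual_self (Ψ := D.supp) (fun t ht u => D.supp_smul ht u) hx
  rwa [← hv] at this

theorem zero_mem_supDifferential_localRoof {v : Place b K} (hv : D.ψ v = D.supp)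
    {x : Fin n → ℝ} (hx : x ∈ D.Δ) : 0 ∈ supDifferential D.Δ (D.localRoof v) x := by
  intro z hz
  rw [localRoof_eq_zero hv hz, localRoof_eq_zero hv hx]
  simp

theorem roof_eq_sum {T : Finset (Place b K)} (hT : ∀ v, v ∉ T → D.ψ v = D.supp) {x : Fin n → ℝ}
    (hx : x ∈ D.Δ) : D.roof x = ∑ v ∈ T, v.weight * D.localRoof v x := by
  refine finsum_eq_sum_of_support_subset _ fun v hv => ?_
  by_contra hvT
  refine hv ?_
  simp only [localRoof_eq_zero (hT v hvT) hx, mul_zero]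

open Classical in
theorem weight_mul_otherRoof [FiniteDimensional K₀ K] {T : Finset (Place b K)}
    (hT : ∀ v, v ∉ T → D.ψ v = D.supp) (v : Place b K) {x : Fin n → ℝ} (hx : x ∈ D.Δ) :
    v.weight * D.otherRoof v x = ∑ w ∈ T.erase v, w.weight * D.localRoof w x := by
  have h : D.otherRoof v x =
      ∑ w ∈ T.subtype (· ≠ v), w.1.weight / v.weight * D.localRoof w.1 x := by
    refine finsum_eq_sum_of_support_subset _ fun w hw => ?_
    by_contra hwT
    refine hw ?_
    have : w.1 ∉ T := fun h => hwT (by simpa using h)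
    simp only [localRoof_eq_zero (hT w.1 this) hx, mul_zero]
  rw [h, Finset.sum_subtype_eq_sum_filter (f := fun w => w.weight / v.weight * D.localRoof w x),
    Finset.filter_ne', Finset.mul_sum]
  refine Finset.sum_congr rfl fun w _ => ?_
  have := v.weight_pos.ne'
  field_simp

theorem exists_finset (D : ToricMetrizedDivisor b K n) (s : Finset (Place b K)) :
    ∃ T : Finset (Place b K), s ⊆ T ∧ ∀ v, v ∉ T → D.ψ v = D.supp := by
  classical
  refine ⟨D.finite_ψ_ne_supp.toFinset ∪ s, Finset.subset_union_right, fun v hv => ?_⟩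
  by_contra h
  exact hv (Finset.mem_union_left _ (by simpa using h))

theorem roof_eq_weight_mul [FiniteDimensional K₀ K] (v : Place b K) {x : Fin n → ℝ}
    (hx : x ∈ D.Δ) : D.roof x = v.weight * (D.localRoof v x + D.otherRoof v x) := by
  classical
  obtain ⟨T, hvT, hT⟩ := D.exists_finset {v}
  rw [mul_add, weight_mul_otherRoof hT v hx, roof_eq_sum hT hx,
    Finset.add_sum_erase T (fun w => w.weight * D.localRoof w x) (hvT (Finset.mem_singleton_self v))]

theorem maxSet_eq_Δmax [FiniteDimensional K₀ K] (v : Place b K) :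
    maxSet D.Δ (fun z => D.localRoof v z + D.otherRoof v z) = D.Δmax := by
  ext x
  refine and_congr_right fun hx => forall₂_congr fun z hz => ?_
  rw [roof_eq_weight_mul v hx, roof_eq_weight_mul v hz, mul_le_mul_iff_right₀ v.weight_pos]

theorem zero_mem_supDifferential_roof {x : Fin n → ℝ} (hx : x ∈ D.Δmax) :
    0 ∈ supDifferential D.Δ D.roof x := by
  intro z hz
  rw [dotProduct_zero, sub_nonpos]
  exact hx.2 z hz

theorem sum_mem_supDifferential_roof [FiniteDimensional K₀ K] {x : Fin n → ℝ} (hx : x ∈ D.Δ)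
    {u : Place b K →₀ (Fin n → ℝ)} (hu : ∀ v, u v ∈ supDifferential D.Δ (D.localRoof v) x) :
    u.sum (fun v y => v.weight • y) ∈ supDifferential D.Δ D.roof x := by
  intro z hz
  obtain ⟨T, hsT, hT⟩ := D.exists_finset u.support
  rw [roof_eq_sum hT hx, roof_eq_sum hT hz,
    Finsupp.sum_of_support_subset u hsT _ (fun _ _ => smul_zero _), dotProduct_sum,
    ← Finset.sum_sub_distrib]
  refine Finset.sum_le_sum fun v _ => ?_
  rw [dotProduct_smul, smul_eq_mul, ← mul_sub]
  exact mul_le_mul_of_nonneg_left (hu v z hz) v.weight_pos.le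

/-- The finite sum rule is applied on a nonempty set of places outside which the metric functions
are canonical. There `0` is a supergradient, so the solution extends by zero. -/
theorem exists_decomposition [FiniteDimensional K₀ K] [hne : Nonempty (Place b K)]
    (hD : D.IsSemipositive) (hbig : D.IsBig) {x y : Fin n → ℝ} (hx : x ∈ D.Δ)
    (hy : y ∈ supDifferential D.Δ D.roof x) :
    ∃ u : Place b K →₀ (Fin n → ℝ), u.sum (fun v y => v.weight • y) = y ∧
      ∀ v, u v ∈ supDifferential D.Δ (D.localRoof v) x := by
  classical
  obtain ⟨v₀⟩ := hne
  obtain ⟨T, hvT, hT⟩ := D.exists_finset {v₀}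
  have : Nonempty T := ⟨⟨v₀, hvT (Finset.mem_singleton_self _)⟩⟩
  have hroof : ∀ z ∈ D.Δ, D.roof z = ∑ v : T, v.1.weight * concaveDual (D.ψ v.1) z := by
    intro z hz
    rw [roof_eq_sum hT hz, ← Finset.sum_coe_sort]
    rfl
  obtain ⟨u, hu, hmem⟩ := exists_decomposition_of_mem_supDifferential_sum (ι := T) (Ψ := D.supp)
    (ψ := fun v => D.ψ v.1) (c := fun v => v.1.weight) (x := x) (y := y)
    (fun v => isMetricFunction hD v.1) (fun v => v.1.weight_pos)
    (fun _ ht u => D.supp_smul ht u) hbig hx (fun z hz => by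
      have := hy z hz
      rwa [hroof x hx, hroof z hz] at this)
  refine ⟨Finsupp.onFinset T (fun v => if h : v ∈ T then u ⟨v, h⟩ else 0) fun v hv => ?_, ?_,
    fun v => ?_⟩
  · by_contra h
    exact hv (dif_neg h)
  · rw [Finsupp.sum_of_support_subset _ Finsupp.support_onFinset_subset _
      (fun _ _ => smul_zero _), ← Finset.sum_coe_sort, ← hu]
    refine Finset.sum_congr rfl fun v _ => ?_
    simp
  · rw [Finsupp.onFinset_apply]
    split_ifs with h
    · exact hmem ⟨v, h⟩
    · exact zero_mem_supDifferential_localRoof (hT v h) hx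

theorem adelicSolutions_nonempty [FiniteDimensional K₀ K] (hD : D.IsSemipositive)
    (hbig : D.IsBig) {x : Fin n → ℝ} (hx : x ∈ D.Δmax) : (D.adelicSolutions x).Nonempty := by
  rcases isEmpty_or_nonempty (Place b K) with h | h
  · exact ⟨0, Finsupp.sum_zero_index, fun v => (h.false v).elim⟩
  · obtain ⟨u, hu, hmem⟩ := exists_decomposition hD hbig hx.1 (zero_mem_supDifferential_roof hx)
    exact ⟨u, hu, hmem⟩

/-- Replacing one component of a solution by `a` changes the weighted total from `0` to this vector.
Local freedom at `v` thus becomes visible in `∂ϑ(x)`. -/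
theorem weight_smul_sub_mem_supDifferential_roof [FiniteDimensional K₀ K] {x : Fin n → ℝ}
    (hx : x ∈ D.Δ) {u : Place b K →₀ (Fin n → ℝ)} (hu : u ∈ D.adelicSolutions x) {v : Place b K}
    {a : Fin n → ℝ} (ha : a ∈ supDifferential D.Δ (D.localRoof v) x) :
    v.weight • (a - u v) ∈ supDifferential D.Δ D.roof x := by
  classical
  have h := sum_mem_supDifferential_roof (u := u + Finsupp.single v (a - u v)) hx fun w => by
    by_cases hw : w = v
    · subst hw; simpa using ha
    · simpa [Finsupp.single_eq_of_ne hw] using hu.2 w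
  have h0 : u.sum (fun v y => v.weight • y) = 0 := hu.1
  have h1 : (Finsupp.single v (a - u v)).sum (fun v y => v.weight • y) = v.weight • (a - u v) :=
    Finsupp.sum_single_index (smul_zero _)
  rwa [Finsupp.sum_add_index' (fun _ => smul_zero _) (fun _ => smul_add _), h0, h1,
    zero_add] at h

/-- If `0` is a vertex of the sup-differential of the roof function, the adelic solution is unique
and consists of vertices. -/
theorem adelicSolutions_eq_singleton_of_vertex [FiniteDimensional K₀ K] (hD : D.IsSemipositive)
    (hbig : D.IsBig) {x : Fin n → ℝ} (hx : x ∈ D.Δmax)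
    (h : 0 ∈ (supDifferential D.Δ D.roof x).extremePoints ℝ) :
    ∃ u, D.adelicSolutions x = {u} ∧
      ∀ v, u v ∈ (supDifferential D.Δ (D.localRoof v) x).extremePoints ℝ := by
  obtain ⟨u, hu⟩ := adelicSolutions_nonempty hD hbig hx
  refine ⟨u, Set.eq_singleton_iff_unique_mem.mpr ⟨hu, fun u' hu' => ?_⟩, fun v => ?_⟩
  · ext1 v
    have hp := weight_smul_sub_mem_supDifferential_roof hx.1 hu (hu'.2 v)
    have hq := weight_smul_sub_mem_supDifferential_roof hx.1 hu' (hu.2 v)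
    have := eq_zero_of_zero_mem_extremePoints h hp hq one_pos one_pos (by
      rw [one_smul, one_smul, ← smul_add]; simp)
    exact sub_eq_zero.mp ((smul_eq_zero.mp this).resolve_left v.weight_pos.ne')
  · refine ⟨hu.2 v, fun p hp q hq hpq => ?_⟩
    obtain ⟨s, t, hs, ht, hst, hsum⟩ := hpq
    have hp' := weight_smul_sub_mem_supDifferential_roof hx.1 hu hp
    have hq' := weight_smul_sub_mem_supDifferential_roof hx.1 hu hq
    have := eq_zero_of_zero_mem_extremePoints h hp' hq' hs ht (by
      rw [smul_comm, smul_comm t, ← smul_add, smul_sub, smul_sub,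
        show s • p - s • u v + (t • q - t • u v) = (s • p + t • q) - (s + t) • u v by module,
        hsum, hst, one_smul, sub_self, smul_zero])
    exact sub_eq_zero.mp ((smul_eq_zero.mp this).resolve_left v.weight_pos.ne')

/-- If `0` lies between `p` and `q`, the same combination of their decompositions is an adelic
solution, hence equals `u`. As the components of `u` are vertices, the decomposition of `p` is `u`
itself, whose total is `0`. -/
theorem vertex_of_adelicSolutions_eq_singleton [FiniteDimensional K₀ K] (hD : D.IsSemipositive)
    (hbig : D.IsBig) {x : Fin n → ℝ} (hx : x ∈ D.Δmax) {u : Place b K →₀ (Fin n → ℝ)}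
    (hu : D.adelicSolutions x = {u})
    (hv : ∀ v, u v ∈ (supDifferential D.Δ (D.localRoof v) x).extremePoints ℝ) :
    0 ∈ (supDifferential D.Δ D.roof x).extremePoints ℝ := by
  refine ⟨zero_mem_supDifferential_roof hx, fun p hp q hq hpq => ?_⟩
  obtain ⟨s, t, hs, ht, hst, hsum⟩ := hpq
  rcases isEmpty_or_nonempty (Place b K) with hempty | hne
  -- Without places the roof vanishes, so `p` and `q` pair nonnegatively with `z - x`. Being
  -- opposite up to scale they pair to zero, and the interior of the polytope forces `p = 0`.
  · have hroof : ∀ z, D.roof z = 0 := fun z => finsum_of_isEmpty _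
    refine eq_zero_of_dotProduct_eq_zero hbig (x := x) fun z hz => ?_
    have h1 := hp z hz
    have h2 := hq z hz
    rw [hroof, hroof, sub_zero] at h1 h2
    have h3 : s * ((z - x) ⬝ᵥ p) + t * ((z - x) ⬝ᵥ q) = 0 := by
      rw [← smul_eq_mul, ← smul_eq_mul, ← dotProduct_smul, ← dotProduct_smul, ← dotProduct_add,
        hsum, dotProduct_zero]
    refine le_antisymm ?_ h1
    by_contra! h4
    have := mul_pos hs h4
    have := mul_nonneg ht.le h2
    linarith
  · obtain ⟨c, hc, hc'⟩ := exists_decomposition hD hbig hx.1 hp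
    obtain ⟨d, hd, hd'⟩ := exists_decomposition hD hbig hx.1 hq
    have hmem : s • c + t • d ∈ D.adelicSolutions x := by
      refine ⟨?_, fun v => convex_supDifferential _ _ _ (hc' v) (hd' v) hs.le ht.le hst⟩
      change (s • c + t • d).sum (fun v y => v.weight • y) = 0
      rw [Finsupp.sum_add_index' (fun _ => smul_zero _) (fun _ => smul_add _),
        Finsupp.sum_smul_index' (fun _ => smul_zero _),
        Finsupp.sum_smul_index' (fun _ => smul_zero _)]
      simp only [smul_comm _ s, smul_comm _ t]
      rw [← Finsupp.smul_sum, ← Finsupp.smul_sum, hc, hd, hsum]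
    rw [hu] at hmem
    have hcu : c = u := by
      ext1 v
      refine (hv v).2 (hc' v) (hd' v) ⟨s, t, hs, ht, hst, ?_⟩
      rw [← hmem]
      simp
    have hu0 : u ∈ D.adelicSolutions x := by rw [hu]; rfl
    have h0 : u.sum (fun v y => v.weight • y) = 0 := hu0.1
    rw [← hc, hcu, h0]

/-- Because the family is centered, `-u_v` is the sum of the other components with the weights `n_w
/ n_v`, hence a supergradient of `g₂`. -/
theorem mem_setB [FiniteDimensional K₀ K] {x : Fin n → ℝ}
    (hx : x ∈ D.Δ) {u : Place b K →₀ (Fin n → ℝ)} (hu : u ∈ D.adelicSolutions x) (v : Place b K) :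
    u v ∈ setB D.Δ (D.localRoof v) (D.otherRoof v) x := by
  classical
  refine ⟨hu.2 v, fun z hz => ?_⟩
  obtain ⟨T, hsT, hT⟩ := D.exists_finset (u.support ∪ {v})
  have hvT : v ∈ T := hsT (by simp)
  have h0 : u.sum (fun v y => v.weight • y) = 0 := hu.1
  rw [Finsupp.sum_of_support_subset u (Finset.subset_union_left.trans hsT) _
    (fun _ _ => smul_zero _), ← Finset.add_sum_erase T _ hvT] at h0
  have hsum : ∑ w ∈ T.erase v, (w.weight * D.localRoof w z - w.weight * D.localRoof w x) ≤
      ∑ w ∈ T.erase v, (z - x) ⬝ᵥ (w.weight • u w) := by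
    refine Finset.sum_le_sum fun w _ => ?_
    rw [dotProduct_smul, smul_eq_mul, ← mul_sub]
    exact mul_le_mul_of_nonneg_left (hu.2 w z hz) w.weight_pos.le
  rw [Finset.sum_sub_distrib, ← weight_mul_otherRoof hT v hz, ← weight_mul_otherRoof hT v hx,
    ← dotProduct_sum, eq_neg_of_add_eq_zero_right h0, ← smul_neg, dotProduct_smul, smul_eq_mul,
    ← mul_sub] at hsum
  exact le_of_mul_le_mul_left hsum v.weight_pos

theorem weight_smul_add_mem_supDifferential_roof [FiniteDimensional K₀ K] {x : Fin n → ℝ}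
    (hx : x ∈ D.Δ) {v : Place b K} {p q : Fin n → ℝ}
    (hp : p ∈ supDifferential D.Δ (D.localRoof v) x)
    (hq : q ∈ supDifferential D.Δ (D.otherRoof v) x) :
    v.weight • (p + q) ∈ supDifferential D.Δ D.roof x := by
  intro z hz
  rw [roof_eq_weight_mul v hx, roof_eq_weight_mul v hz, dotProduct_smul, smul_eq_mul, ← mul_sub,
    dotProduct_add]
  refine mul_le_mul_of_nonneg_left ?_ v.weight_pos.le
  have := hp z hz
  have := hq z hz
  linarith

/-- For two points of this set, both differences, scaled by the weight, lie in `∂ϑ(x)`. They are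
opposite, so a vertex at `0` makes them vanish. -/
theorem setB_eq_singleton [FiniteDimensional K₀ K] {x : Fin n → ℝ}
    (hx : x ∈ D.Δ) {u : Place b K →₀ (Fin n → ℝ)} (hu : u ∈ D.adelicSolutions x)
    (h : 0 ∈ (supDifferential D.Δ D.roof x).extremePoints ℝ) (v : Place b K) :
    setB D.Δ (D.localRoof v) (D.otherRoof v) x = {u v} := by
  refine Set.eq_singleton_iff_unique_mem.mpr ⟨mem_setB hx hu v, fun a ha => ?_⟩
  have hB := mem_setB hx hu v
  have := eq_zero_of_zero_mem_extremePoints h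
    (weight_smul_add_mem_supDifferential_roof hx ha.1 hB.2)
    (weight_smul_add_mem_supDifferential_roof hx hB.1 ha.2) one_pos one_pos (by
      rw [one_smul, one_smul, ← smul_add]; simp)
  rw [← sub_eq_add_neg] at this
  exact sub_eq_zero.mp ((smul_eq_zero.mp this).resolve_left v.weight_pos.ne')

theorem mem_F_iff [FiniteDimensional K₀ K] {v : Place b K} {a : Fin n → ℝ} :
    a ∈ D.F v ↔ ∃ x ∈ D.Δmax, a ∈ minimalFace (supDifferential D.Δ (D.localRoof v) x)
      (setB D.Δ (D.localRoof v) (D.otherRoof v) x) := by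
  rw [← maxSet_eq_Δmax v]
  rfl

theorem F_eq_singleton [FiniteDimensional K₀ K] (hne : D.Δmax.Nonempty)
    {u : Place b K →₀ (Fin n → ℝ)} (hu : ∀ x ∈ D.Δmax, D.adelicSolutions x = {u})
    (hv : ∀ x ∈ D.Δmax, ∀ v, u v ∈ (supDifferential D.Δ (D.localRoof v) x).extremePoints ℝ)
    (h : ∀ x ∈ D.Δmax, 0 ∈ (supDifferential D.Δ D.roof x).extremePoints ℝ) (v : Place b K) :
    D.F v = {u v} := by
  have hface : ∀ x ∈ D.Δmax, minimalFace (supDifferential D.Δ (D.localRoof v) x)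
      (setB D.Δ (D.localRoof v) (D.otherRoof v) x) = {u v} := by
    intro x hx
    rw [setB_eq_singleton hx.1 (by rw [hu x hx]; rfl) (h x hx) v,
      minimalFace_eq_singleton (hv x hx v)]
  ext a
  rw [mem_F_iff]
  constructor
  · rintro ⟨x, hx, ha⟩
    rwa [hface x hx] at ha
  · intro ha
    obtain ⟨x, hx⟩ := hne
    exact ⟨x, hx, by rwa [hface x hx]⟩

/-- The components of any solution lie in the minimal face at `x`, which is contained in `F_v`.
One-point sets give uniqueness, and a one-point minimal face is a vertex. -/
theorem adelicSolutions_eq_singleton_of_F [FiniteDimensional K₀ K] (hD : D.IsSemipositive)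
    (hbig : D.IsBig) (hF : ∀ v, ∃ a, D.F v = {a}) {x : Fin n → ℝ} (hx : x ∈ D.Δmax) :
    ∃ u, D.adelicSolutions x = {u} ∧
      ∀ v, u v ∈ (supDifferential D.Δ (D.localRoof v) x).extremePoints ℝ := by
  choose a ha using hF
  have hsub : ∀ v, minimalFace (supDifferential D.Δ (D.localRoof v) x)
      (setB D.Δ (D.localRoof v) (D.otherRoof v) x) ⊆ {a v} := fun v p hp => by
    rw [← ha v]
    exact mem_F_iff.mpr ⟨x, hx, hp⟩
  have heq : ∀ u ∈ D.adelicSolutions x, ∀ v, u v = a v := fun u hu v =>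
    hsub v (subset_minimalFace _ _ (mem_setB hx.1 hu v))
  obtain ⟨u, hu⟩ := adelicSolutions_nonempty hD hbig hx
  refine ⟨u, Set.eq_singleton_iff_unique_mem.mpr ⟨hu, fun u' hu' => ?_⟩, fun v => ?_⟩
  · ext1 v
    rw [heq u' hu', heq u hu]
  · refine mem_extremePoints_of_minimalFace_eq_singleton (Set.Subset.antisymm
      (by rw [heq u hu v]; exact hsub v) ?_) (hu.2 v)
    exact Set.singleton_subset_iff.mpr (subset_minimalFace _ _ (mem_setB hx.1 hu v))

/-- On the polytope, which is compact, the roof is a finite positive combination of upper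
semicontinuous infima of affine functions. -/
theorem Δmax_nonempty [FiniteDimensional K₀ K] (hD : D.IsSemipositive) (hbig : D.IsBig) :
    D.Δmax.Nonempty := by
  rcases isEmpty_or_nonempty (Place b K) with h | ⟨⟨v₀⟩⟩
  · have hroof : ∀ z, D.roof z = 0 := fun z => finsum_of_isEmpty _
    obtain ⟨x, hx⟩ := hbig
    exact ⟨x, interior_subset hx, fun z _ => by rw [hroof, hroof]⟩
  obtain ⟨T, -, hT⟩ := D.exists_finset ∅
  have hcomp : IsCompact D.Δ :=
    (isMetricFunction hD v₀).isCompact_polytope fun _ ht u => D.supp_smul ht u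
  have husc : UpperSemicontinuousOn (fun x => ∑ v ∈ T, v.weight * D.localRoof v x) D.Δ :=
    upperSemicontinuousOn_sum fun v _ =>
      (continuous_const.mul continuous_id).comp_upperSemicontinuousOn
        (isMetricFunction hD v).upperSemicontinuousOn_concaveDual
        (monotone_id.const_mul v.weight_pos.le)
  obtain ⟨x, hx, hmax⟩ := husc.exists_isMaxOn (hbig.mono interior_subset) hcomp
  refine ⟨x, hx, fun z hz => ?_⟩
  rw [roof_eq_sum hT hx, roof_eq_sum hT hz]
  exact hmax hz

end ToricMetrizedDivisor

/-! ## Measures supported on sup-differentials -/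

section Barycenter

variable {n : ℕ} {ν : Measure (Fin n → ℝ)}

theorem integral_dotProduct (hν : Integrable (fun u => u) ν) (x : Fin n → ℝ) :
    ∫ u, x ⬝ᵥ u ∂ν = x ⬝ᵥ ∫ u, u ∂ν := by
  let ℓ : (Fin n → ℝ) →L[ℝ] ℝ := LinearMap.toContinuousLinearMap (dotProductBilin ℝ ℝ x)
  exact ℓ.integral_comp_comm hν

theorem integrable_dotProduct (hν : Integrable (fun u => u) ν) (x : Fin n → ℝ) :
    Integrable (fun u => x ⬝ᵥ u) ν := by
  let ℓ : (Fin n → ℝ) →L[ℝ] ℝ := LinearMap.toContinuousLinearMap (dotProductBilin ℝ ℝ x)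
  exact ℓ.integrable_comp hν

/-- A probability measure on a closed convex set whose barycenter is an extreme point is a Dirac
measure. -/
theorem eq_dirac_of_integral_mem_extremePoints [IsProbabilityMeasure ν] {A : Set (Fin n → ℝ)} (hA : Convex ℝ A)
    (hcl : IsClosed A) (hν : Integrable (fun u => u) ν) (hmem : ∀ᵐ u ∂ν, u ∈ A)
    (hext : ∫ u, u ∂ν ∈ A.extremePoints ℝ) : ν = Measure.dirac (∫ u, u ∂ν) := by
  set m := ∫ u, u ∂ν with hm
  -- Otherwise the half-space `H` has positive mass and the mean lies between the averages over `H`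
  -- and its complement. Extremality makes the average over `H` equal to `m`, although its `i`-th
  -- coordinate is smaller.
  have hcoord : ∀ i, ∀ᵐ u ∂ν, m i ≤ u i := by
    intro i
    by_contra hnot
    let H : Set (Fin n → ℝ) := {u | u i < m i}
    have hH : MeasurableSet H := measurableSet_lt (measurable_pi_apply i) measurable_const
    have hH0 : ν H ≠ 0 := by
      intro h0
      refine hnot ?_
      rw [ae_iff]
      simpa [H] using h0
    have hint_lt : ∫ u in H, (m i - u i) ∂ν > 0 := by
      have hi : Integrable (fun u : Fin n → ℝ => m i - u i) ν :=
        (integrable_const _).sub (hν.eval i)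
      rw [gt_iff_lt, setIntegral_pos_iff_support_of_nonneg_ae]
      · rw [pos_iff_ne_zero]
        refine fun h0 => hH0 (measure_mono_null ?_ h0)
        intro u hu
        exact ⟨(sub_pos.mpr hu).ne', hu⟩
      · exact (ae_restrict_iff' hH).mpr (Filter.Eventually.of_forall fun u hu => (sub_pos.mpr hu).le)
      · exact hi.integrableOn
    have hmi : ∫ u, (m i - u i) ∂ν = 0 := by
      rw [integral_sub (integrable_const _) (hν.eval i), integral_const, hm, eval_integral]
      · simp
      · exact fun j => hν.eval j
    have hHc0 : ν Hᶜ ≠ 0 := by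
      intro h0
      have : ∫ u in H, (m i - u i) ∂ν = ∫ u, (m i - u i) ∂ν := by
        rw [Measure.restrict_eq_self_of_ae_mem]
        exact h0
      rw [this, hmi] at hint_lt
      exact lt_irrefl _ hint_lt
    have havg : ∀ s : Set (Fin n → ℝ), ν s ≠ 0 → (⨍ u in s, u ∂ν) ∈ A := fun s hs =>
      hA.set_average_mem hcl hs (measure_ne_top _ _) (ae_restrict_of_ae hmem) hν.integrableOn
    have hseg := average_mem_openSegment_compl_self hH.nullMeasurableSet hH0 hHc0 hν
    rw [average_eq_integral ν fun u => u] at hseg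
    have heq := hext.2 (havg H hH0) (havg Hᶜ hHc0) hseg
    have hr : 0 < ν.real H := ENNReal.toReal_pos hH0 (measure_ne_top _ _)
    have h1 : ∫ u in H, u i ∂ν = ν.real H * m i := by
      rw [← heq, setAverage_eq, Pi.smul_apply, smul_eq_mul, ← mul_assoc,
        mul_inv_cancel₀ hr.ne', one_mul, eval_integral]
      exact fun j => (hν.eval j).integrableOn
    rw [integral_sub (integrable_const _).integrableOn (hν.eval i).integrableOn, h1] at hint_lt
    simp at hint_lt
  have hae : ∀ᵐ u ∂ν, u = m := by
    -- A nonnegative deviation with zero integral vanishes almost everywhere.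
    have : ∀ i, ∀ᵐ u ∂ν, u i = m i := by
      intro i
      have hi : Integrable (fun u : Fin n → ℝ => u i - m i) ν :=
        (hν.eval i).sub (integrable_const _)
      have h0 : ∫ u, (u i - m i) ∂ν = 0 := by
        rw [integral_sub (hν.eval i) (integrable_const _), integral_const, hm, eval_integral]
        · simp
        · exact fun j => hν.eval j
      have := (integral_eq_zero_iff_of_nonneg_ae
        ((hcoord i).mono fun u hu => sub_nonneg.mpr hu) hi).mp h0
      filter_upwards [this] with u hu
      exact sub_eq_zero.mp hu
    filter_upwards [ae_all_iff.mpr this] with u hu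
    exact funext hu
  refine Measure.ext fun s hs => ?_
  rw [Measure.dirac_apply' _ hs]
  by_cases hms : m ∈ s
  · rw [Set.indicator_of_mem hms, Pi.one_apply, ← measure_univ (μ := ν)]
    refine measure_congr ?_
    filter_upwards [hae] with u hu
    subst hu
    exact propext ⟨fun _ => trivial, fun _ => hms⟩
  · rw [Set.indicator_of_notMem hms, measure_eq_zero_iff_ae_notMem]
    filter_upwards [hae] with u hu
    rwa [hu]

end Barycenter

section Contact

variable {n : ℕ} {ν : Measure (Fin n → ℝ)} [IsProbabilityMeasure ν] {Ψ ψ : (Fin n → ℝ) → ℝ}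

theorem IsMetricFunction.integrable (h : IsMetricFunction Ψ ψ)
    (hΨ : ∀ t : ℝ, 0 ≤ t → ∀ u, Ψ (t • u) = t * Ψ u) (hν : Integrable (fun u => u) ν) :
    Integrable ψ ν := by
  obtain ⟨A, B, hAB⟩ := h.exists_abs_le hΨ
  exact ((integrable_const A).add (hν.norm.const_mul B)).mono'
    h.continuous.aestronglyMeasurable (Filter.Eventually.of_forall hAB)

theorem IsMetricFunction.integral_le (h : IsMetricFunction Ψ ψ)
    (hΨ : ∀ t : ℝ, 0 ≤ t → ∀ u, Ψ (t • u) = t * Ψ u) (hν : Integrable (fun u => u) ν)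
    {x : Fin n → ℝ} (hx : x ∈ polytope Ψ) :
    ∫ u, ψ u ∂ν ≤ x ⬝ᵥ (∫ u, u ∂ν) - concaveDual ψ x := by
  rw [← integral_dotProduct hν]
  have := integral_mono (μ := ν) (h.integrable hΨ hν)
    ((integrable_dotProduct hν x).sub (integrable_const (concaveDual ψ x)))
    fun u => le_sub_comm.mp (h.concaveDual_le hx u)
  rw [integral_sub' (integrable_dotProduct hν x) (integrable_const _)] at this
  simpa using this

/-- The integrand of the difference is nonnegative and vanishes exactly on the contact set. -/
theorem IsMetricFunction.integral_eq_iff (h : IsMetricFunction Ψ ψ)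
    (hΨ : ∀ t : ℝ, 0 ≤ t → ∀ u, Ψ (t • u) = t * Ψ u) (hν : Integrable (fun u => u) ν)
    {x : Fin n → ℝ} (hx : x ∈ polytope Ψ) :
    ∫ u, ψ u ∂ν = x ⬝ᵥ (∫ u, u ∂ν) - concaveDual ψ x ↔
      ∀ᵐ u ∂ν, u ∈ supDifferential (polytope Ψ) (concaveDual ψ) x := by
  have hi : Integrable (fun u => x ⬝ᵥ u - concaveDual ψ x - ψ u) ν :=
    ((integrable_dotProduct hν x).sub (integrable_const _)).sub (h.integrable hΨ hν)
  have hint : ∫ u, (x ⬝ᵥ u - concaveDual ψ x - ψ u) ∂ν =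
      x ⬝ᵥ (∫ u, u ∂ν) - concaveDual ψ x - ∫ u, ψ u ∂ν := by
    rw [integral_sub (f := fun u => x ⬝ᵥ u - concaveDual ψ x)
      ((integrable_dotProduct hν x).sub (integrable_const _)) (h.integrable hΨ hν), integral_sub (integrable_dotProduct hν x) (integrable_const _),
      integral_dotProduct hν]
    simp
  have hnn : 0 ≤ fun u => x ⬝ᵥ u - concaveDual ψ x - ψ u := fun u => by
    have := h.concaveDual_le hx u
    simp only [Pi.zero_apply]
    linarith
  have := integral_eq_zero_iff_of_nonneg hnn hi
  rw [hint] at this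
  rw [eq_comm, ← sub_eq_zero, this]
  refine Filter.eventually_congr (Filter.Eventually.of_forall fun u => ?_)
  rw [h.mem_supDifferential_iff hΨ hx]
  simp only [Pi.zero_apply]
  rw [sub_eq_zero, eq_comm]

end Contact

/-! ## Minimizers on centered adelic measures -/

namespace ToricMetrizedDivisor

variable {K₀ : Type u} [Field K₀] {b : BaseField K₀} {K : Type w} [Field K] [Algebra K₀ K] {n : ℕ}
  {D : ToricMetrizedDivisor b K n}

theorem integrable_dirac_id (a : Fin n → ℝ) :
    Integrable (fun u : Fin n → ℝ => u) (Measure.dirac a) := by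
  exact integrable_dirac (by simp)

theorem exists_finset_of_mem_centeredAdelicMeasures (D : ToricMetrizedDivisor b K n)
    {ν : Place b K → ProbabilityMeasure (Fin n → ℝ)} (hν : ν ∈ centeredAdelicMeasures b K n) :
    ∃ T : Finset (Place b K), (∀ v, v ∉ T → D.ψ v = D.supp) ∧
      (∀ v, v ∉ T → (ν v : Measure (Fin n → ℝ)) = Measure.dirac 0) ∧
      ∑ v ∈ T, v.weight • ∫ u, u ∂(ν v : Measure (Fin n → ℝ)) = 0 ∧
      D.η ν = -∑ v ∈ T, v.weight * ∫ u, D.ψ v u ∂(ν v : Measure (Fin n → ℝ)) := by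
  obtain ⟨T, hsT, hT⟩ := D.exists_finset hν.2.1.toFinset
  have hdirac : ∀ v, v ∉ T → (ν v : Measure (Fin n → ℝ)) = Measure.dirac 0 := by
    intro v hv
    by_contra h
    exact hv (hsT (by simpa using h))
  refine ⟨T, hT, hdirac, ?_, ?_⟩
  · rw [← hν.2.2]
    refine (finsum_eq_sum_of_support_subset _ fun v hv => ?_).symm
    by_contra hvT
    refine hv ?_
    simp only [hdirac v hvT, integral_dirac, smul_zero]
  · rw [η, neg_inj]
    refine finsum_eq_sum_of_support_subset _ fun v hv => ?_
    by_contra hvT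
    refine hv ?_
    have h0 : D.supp 0 = 0 := by simpa using D.supp_smul le_rfl (0 : Fin n → ℝ)
    simp only [hdirac v hvT, hT v hvT, integral_dirac, h0, mul_zero]

/-- Centering cancels the linear terms, so `η ν - ϑ(x)` is a weighted sum of nonnegative local
defects, and it vanishes only if all of them do. -/
theorem roof_le_η [FiniteDimensional K₀ K] (hD : D.IsSemipositive) {x : Fin n → ℝ}
    (hx : x ∈ D.Δ) {ν : Place b K → ProbabilityMeasure (Fin n → ℝ)}
    (hν : ν ∈ centeredAdelicMeasures b K n) :
    D.roof x ≤ D.η ν ∧ (D.η ν = D.roof x ↔ ∀ v, ∀ᵐ u ∂(ν v : Measure (Fin n → ℝ)),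
      u ∈ supDifferential D.Δ (D.localRoof v) x) := by
  obtain ⟨T, hT, hdirac, hsum, hη⟩ := D.exists_finset_of_mem_centeredAdelicMeasures hν
  have hle : ∀ v, ∫ u, D.ψ v u ∂(ν v : Measure (Fin n → ℝ)) ≤
      x ⬝ᵥ (∫ u, u ∂(ν v : Measure (Fin n → ℝ))) - D.localRoof v x := fun v =>
    (isMetricFunction hD v).integral_le (fun _ ht u => D.supp_smul ht u) (hν.1 v) hx
  have hiff : ∀ v, _ ↔ _ := fun v => (isMetricFunction hD v).integral_eq_iff
    (ν := (ν v : Measure (Fin n → ℝ))) (fun _ ht u => D.supp_smul ht u) (hν.1 v) hx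
  have hdiff : D.η ν - D.roof x = ∑ v ∈ T, v.weight *
      (x ⬝ᵥ (∫ u, u ∂(ν v : Measure (Fin n → ℝ))) - D.localRoof v x -
        ∫ u, D.ψ v u ∂(ν v : Measure (Fin n → ℝ))) := by
    have h0 : x ⬝ᵥ (∑ v ∈ T, v.weight • ∫ u, u ∂(ν v : Measure (Fin n → ℝ))) = 0 := by
      rw [hsum, dotProduct_zero]
    rw [dotProduct_sum] at h0
    simp only [dotProduct_smul, smul_eq_mul] at h0
    rw [hη, roof_eq_sum hT hx]
    simp only [mul_sub, Finset.sum_sub_distrib]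
    linarith
  have hnn : ∀ v ∈ T, 0 ≤ v.weight *
      (x ⬝ᵥ (∫ u, u ∂(ν v : Measure (Fin n → ℝ))) - D.localRoof v x -
        ∫ u, D.ψ v u ∂(ν v : Measure (Fin n → ℝ))) := fun v _ =>
    mul_nonneg v.weight_pos.le (sub_nonneg.mpr (hle v))
  refine ⟨sub_nonneg.mp (hdiff ▸ Finset.sum_nonneg hnn), ?_⟩
  rw [← sub_eq_zero, hdiff, Finset.sum_eq_zero_iff_of_nonneg hnn]
  constructor
  · intro h v
    by_cases hv : v ∈ T
    · refine (hiff v).mp ?_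
      have := (mul_eq_zero.mp (h v hv)).resolve_left v.weight_pos.ne'
      exact (sub_eq_zero.mp this).symm
    · rw [hdirac v hv]
      refine (ae_dirac_iff (isClosed_supDifferential _ _ _).measurableSet).mpr ?_
      exact zero_mem_supDifferential_localRoof (hT v hv) hx
  · intro h v _
    rw [mul_eq_zero, sub_eq_zero]
    exact Or.inr ((hiff v).mpr (h v)).symm

theorem diracFamily_mem_centeredAdelicMeasures {u : Place b K →₀ (Fin n → ℝ)}
    (hu : u ∈ adelicHyperplane b K n) : diracFamily u ∈ centeredAdelicMeasures b K n := by
  refine ⟨fun v => integrable_dirac_id _, u.hasFiniteSupport.subset fun v hv h0 => hv ?_, ?_⟩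
  · change Measure.dirac (u v) = _
    rw [h0]
  · have h0 : u.sum (fun v y => v.weight • y) = 0 := hu
    rw [← h0]
    simp only [diracFamily, ProbabilityMeasure.coe_mk, integral_dirac]
    refine finsum_eq_sum_of_support_subset _ fun v hv => ?_
    by_contra h
    refine hv ?_
    have : u v = 0 := Finsupp.notMem_support_iff.mp h
    simp only [this, smul_zero]

/-- The lower bound `ϑ(x)` is attained by the Dirac family of an adelic solution, so minimizers are
the cases of equality in `roof_le_η`. -/
theorem isMinimizer_iff [FiniteDimensional K₀ K] (hD : D.IsSemipositive) (hbig : D.IsBig)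
    {x : Fin n → ℝ} (hx : x ∈ D.Δmax) {ν : Place b K → ProbabilityMeasure (Fin n → ℝ)} :
    D.IsMinimizer ν ↔ ν ∈ centeredAdelicMeasures b K n ∧
      ∀ v, ∀ᵐ u ∂(ν v : Measure (Fin n → ℝ)), u ∈ supDifferential D.Δ (D.localRoof v) x := by
  refine and_congr_right fun hν => ?_
  rw [← (roof_le_η hD hx.1 hν).2]
  constructor
  · intro h
    obtain ⟨u, hu⟩ := adelicSolutions_nonempty hD hbig hx
    have hmem := diracFamily_mem_centeredAdelicMeasures hu.1
    refine le_antisymm ((h _ hmem).trans_eq ?_) (roof_le_η hD hx.1 hν).1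
    refine (roof_le_η hD hx.1 hmem).2.mpr fun v => ?_
    exact (ae_dirac_iff (isClosed_supDifferential _ _ _).measurableSet).mpr (hu.2 v)
  · intro h ν' hν'
    rw [h]
    exact (roof_le_η hD hx.1 hν').1

theorem isMinimizer_diracFamily [FiniteDimensional K₀ K] (hD : D.IsSemipositive) (hbig : D.IsBig)
    {x : Fin n → ℝ} (hx : x ∈ D.Δmax) {u : Place b K →₀ (Fin n → ℝ)}
    (hu : u ∈ D.adelicSolutions x) : D.IsMinimizer (diracFamily u) :=
  (isMinimizer_iff hD hbig hx).mpr ⟨diracFamily_mem_centeredAdelicMeasures hu.1, fun v =>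
    (ae_dirac_iff (isClosed_supDifferential _ _ _).measurableSet).mpr (hu.2 v)⟩

theorem diracFamily_injective :
    Function.Injective (diracFamily : (Place b K →₀ (Fin n → ℝ)) → _) := by
  intro u u' h
  ext1 v
  have := congrArg (fun ν : Place b K → ProbabilityMeasure (Fin n → ℝ) =>
    (ν v : Measure (Fin n → ℝ))) h
  exact dirac_eq_dirac_iff.mp this

/-- The barycenters of a minimizer form an adelic solution, hence equal `u`. Since they are
vertices, each measure collapses to a Dirac mass. -/
theorem isCriticalPoint_of_adelicSolutions_eq_singleton [FiniteDimensional K₀ K]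
    (hD : D.IsSemipositive) (hbig : D.IsBig) {x : Fin n → ℝ} (hx : x ∈ D.Δmax)
    {u : Place b K →₀ (Fin n → ℝ)} (hu : D.adelicSolutions x = {u})
    (hv : ∀ v, u v ∈ (supDifferential D.Δ (D.localRoof v) x).extremePoints ℝ) :
    D.IsCriticalPoint u := by
  have hu0 : u ∈ D.adelicSolutions x := by rw [hu]; rfl
  refine ⟨hu0.1, fun ν => ⟨fun h => ?_, ?_⟩⟩
  · obtain ⟨hν, hae⟩ := (isMinimizer_iff hD hbig hx).mp h
    have hmem : ∀ v, ∫ y, y ∂(ν v : Measure (Fin n → ℝ)) ∈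
        supDifferential D.Δ (D.localRoof v) x := fun v =>
      (convex_supDifferential _ _ _).integral_mem (isClosed_supDifferential _ _ _) (hae v) (hν.1 v)
    obtain ⟨T, -, hdirac, hsum, -⟩ := D.exists_finset_of_mem_centeredAdelicMeasures hν
    let c : Place b K →₀ (Fin n → ℝ) :=
      Finsupp.onFinset T (fun v => ∫ y, y ∂(ν v : Measure (Fin n → ℝ))) fun v hv => by
        by_contra h
        refine hv ?_
        rw [hdirac v h, integral_dirac]
    have hc : c ∈ D.adelicSolutions x := by
      refine ⟨?_, hmem⟩
      change c.sum (fun v y => v.weight • y) = 0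
      rw [Finsupp.sum_of_support_subset _ Finsupp.support_onFinset_subset _
        (fun _ _ => smul_zero _)]
      exact hsum
    rw [hu] at hc
    have hcu : ∀ v, ∫ y, y ∂(ν v : Measure (Fin n → ℝ)) = u v := fun v =>
      DFunLike.congr_fun (Set.mem_singleton_iff.mp hc) v
    funext v
    refine Subtype.ext ?_
    have := eq_dirac_of_integral_mem_extremePoints (convex_supDifferential _ _ _)
      (isClosed_supDifferential _ _ _) (hν.1 v) (hae v) (by rw [hcu]; exact hv v)
    rw [hcu] at this
    exact this
  · rintro rfl
    exact isMinimizer_diracFamily hD hbig hx hu0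

theorem adelicSolutions_eq_singleton_of_isMonocritical [FiniteDimensional K₀ K]
    (hD : D.IsSemipositive) (hbig : D.IsBig) (hmono : D.IsMonocritical) {x : Fin n → ℝ}
    (hx : x ∈ D.Δmax) :
    ∃ u, D.adelicSolutions x = {u} ∧
      ∀ v, u v ∈ (supDifferential D.Δ (D.localRoof v) x).extremePoints ℝ := by
  classical
  obtain ⟨u, hu⟩ := adelicSolutions_nonempty hD hbig hx
  have hmin := isMinimizer_diracFamily hD hbig hx hu
  refine ⟨u, Set.eq_singleton_iff_unique_mem.mpr ⟨hu, fun u' hu' => ?_⟩, fun v => ?_⟩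
  · exact diracFamily_injective
      (hmono.unique (isMinimizer_diracFamily hD hbig hx hu') hmin)
  refine ⟨hu.2 v, fun p hp q hq hpq => ?_⟩
  obtain ⟨s, t, hs, ht, hst, hsum⟩ := hpq
  -- Spreading the mass at `u v` over the endpoints `p` and `q` keeps the barycenter and stays in
  -- the sup-differential. It gives a second minimizer unless the endpoints coincide with `u v`.
  let μ : Measure (Fin n → ℝ) :=
    ENNReal.ofReal s • Measure.dirac p + ENNReal.ofReal t • Measure.dirac q
  have hμ : IsProbabilityMeasure μ := ⟨by
    simp only [μ, Measure.add_apply, Measure.smul_apply, measure_univ, smul_eq_mul, mul_one]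
    rw [← ENNReal.ofReal_add hs.le ht.le, hst, ENNReal.ofReal_one]⟩
  have hip : Integrable (fun u : Fin n → ℝ => u) (ENNReal.ofReal s • Measure.dirac p) :=
    (integrable_dirac_id p).smul_measure ENNReal.ofReal_ne_top
  have hiq : Integrable (fun u : Fin n → ℝ => u) (ENNReal.ofReal t • Measure.dirac q) :=
    (integrable_dirac_id q).smul_measure ENNReal.ofReal_ne_top
  have hμint : ∫ y, y ∂μ = u v := by
    rw [integral_add_measure hip hiq, integral_smul_measure, integral_smul_measure,
      integral_dirac, integral_dirac, ENNReal.toReal_ofReal hs.le, ENNReal.toReal_ofReal ht.le,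
      hsum]
  let ν : Place b K → ProbabilityMeasure (Fin n → ℝ) :=
    Function.update (diracFamily u) v ⟨μ, hμ⟩
  have hνv : (ν v : Measure (Fin n → ℝ)) = μ := by
    have : ν v = ⟨μ, hμ⟩ := Function.update_self v _ (diracFamily u)
    rw [this]
    rfl
  have hνw : ∀ w, w ≠ v → ν w = diracFamily u w := fun w hw => Function.update_of_ne hw _ _
  have hν : ν ∈ centeredAdelicMeasures b K n := by
    refine ⟨fun w => ?_, ?_, ?_⟩
    · by_cases hw : w = v
      · subst hw
        rw [hνv]
        exact hip.add_measure hiq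
      · rw [hνw w hw]
        exact integrable_dirac_id _
    · refine (hmin.1.2.1.union (Set.finite_singleton v)).subset fun w hw => ?_
      by_cases hwv : w = v
      · exact Or.inr hwv
      · refine Or.inl ?_
        have hw' : (ν w : Measure (Fin n → ℝ)) ≠ Measure.dirac 0 := hw
        rwa [hνw w hwv] at hw'
    · rw [← hmin.1.2.2]
      refine finsum_congr fun w => ?_
      by_cases hw : w = v
      · subst hw
        rw [hνv, hμint]
        simp [diracFamily]
      · rw [hνw w hw]
  have hνmin : D.IsMinimizer ν := by
    refine (isMinimizer_iff hD hbig hx).mpr ⟨hν, fun w => ?_⟩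
    by_cases hw : w = v
    · subst hw
      rw [hνv, ae_add_measure_iff]
      exact ⟨Measure.ae_smul_measure ((ae_dirac_iff
        (isClosed_supDifferential _ _ _).measurableSet).mpr hp) _, Measure.ae_smul_measure
        ((ae_dirac_iff (isClosed_supDifferential _ _ _).measurableSet).mpr hq) _⟩
    · rw [hνw w hw]
      exact ((isMinimizer_iff hD hbig hx).mp hmin).2 w
  have heq := hmono.unique hνmin hmin
  have hμeq : μ = Measure.dirac (u v) := by
    rw [← hνv, heq]
    rfl
  -- If `p ≠ u v`, the atom at `p` has mass `s > 0` outside `{u v}`, which the equality with a Dirac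
  -- mass forbids.
  by_contra hne
  have hm : MeasurableSet ({u v}ᶜ : Set (Fin n → ℝ)) := (measurableSet_singleton _).compl
  have h1 : μ {u v}ᶜ = 0 := by
    rw [hμeq, Measure.dirac_apply' _ hm]
    simp
  have h2 : (ENNReal.ofReal s • Measure.dirac p) ({u v}ᶜ : Set (Fin n → ℝ)) = 0 :=
    le_antisymm ((Measure.le_add_right le_rfl _).trans_eq h1) zero_le
  rw [Measure.smul_apply, Measure.dirac_apply' _ hm, Set.indicator_of_mem (by simpa using hne)]
    at h2
  simp only [Pi.one_apply, smul_eq_mul, mul_one, ENNReal.ofReal_eq_zero] at h2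
  exact absurd hs (not_lt.mpr h2)

end ToricMetrizedDivisor
end ToricHeights

/-! ### The equivalence of the five conditions -/

open ToricHeights ToricMetrizedDivisor in
theorem proposition3p12 {K₀ : Type*} [Field K₀] (b : ToricHeights.BaseField K₀)
    {K : Type*} [Field K] [Algebra K₀ K] [FiniteDimensional K₀ K] {n : ℕ}
    (D : ToricHeights.ToricMetrizedDivisor b K n)
    (hsemi : D.IsSemipositive) (hbig : D.IsBig) :
    List.TFAE [
      D.IsMonocritical,
      ∀ x ∈ D.Δmax, ∃ u, D.adelicSolutions x = {u} ∧
        ∀ v, u v ∈ (ToricHeights.supDifferential D.Δ (D.localRoof v) x).extremePoints ℝ,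
      ∀ x ∈ D.Δmax, 0 ∈ (ToricHeights.supDifferential D.Δ D.roof x).extremePoints ℝ,
      ∃ x ∈ D.Δmax, 0 ∈ (ToricHeights.supDifferential D.Δ D.roof x).extremePoints ℝ,
      ∀ v, ∃ a, D.F v = {a}] ∧
    (D.IsMonocritical → ∃ u, D.IsCriticalPoint u ∧ (∀ x ∈ D.Δmax, D.adelicSolutions x = {u}) ∧
      ∀ v, D.F v = {u v}) := by
  obtain ⟨x₀, hx₀⟩ := Δmax_nonempty hsemi hbig
  have h12 := fun h : D.IsMonocritical => fun x (hx : x ∈ D.Δmax) =>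
    adelicSolutions_eq_singleton_of_isMonocritical hsemi hbig h hx
  have h23 : (∀ x ∈ D.Δmax, ∃ u, D.adelicSolutions x = {u} ∧
        ∀ v, u v ∈ (supDifferential D.Δ (D.localRoof v) x).extremePoints ℝ) →
      ∀ x ∈ D.Δmax, 0 ∈ (supDifferential D.Δ D.roof x).extremePoints ℝ := by
    intro h x hx
    obtain ⟨u, hu, hv⟩ := h x hx
    exact vertex_of_adelicSolutions_eq_singleton hsemi hbig hx hu hv
  have h41 : (∃ x ∈ D.Δmax, 0 ∈ (supDifferential D.Δ D.roof x).extremePoints ℝ) →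
      D.IsMonocritical := by
    rintro ⟨x, hx, h⟩
    obtain ⟨u, hu, hv⟩ := adelicSolutions_eq_singleton_of_vertex hsemi hbig hx h
    have hcrit := isCriticalPoint_of_adelicSolutions_eq_singleton hsemi hbig hx hu hv
    exact ⟨diracFamily u, (hcrit.2 _).mpr rfl, fun ν hν => (hcrit.2 ν).mp hν⟩
  have hmain : D.IsMonocritical → ∃ u, D.IsCriticalPoint u ∧
      (∀ x ∈ D.Δmax, D.adelicSolutions x = {u}) ∧ ∀ v, D.F v = {u v} := by
    intro h
    obtain ⟨u, hu, hv⟩ := h12 h x₀ hx₀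
    have hcrit := isCriticalPoint_of_adelicSolutions_eq_singleton hsemi hbig hx₀ hu hv
    have hall : ∀ x ∈ D.Δmax, D.adelicSolutions x = {u} ∧
        ∀ v, u v ∈ (supDifferential D.Δ (D.localRoof v) x).extremePoints ℝ := by
      intro x hx
      obtain ⟨u', hu', hv'⟩ := h12 h x hx
      have hmem : u' ∈ D.adelicSolutions x := by rw [hu']; rfl
      -- The notion of minimizer does not involve `x`, so its uniqueness identifies the solutions
      -- found at different maximum points.
      have : u' = u :=
        diracFamily_injective ((hcrit.2 _).mp (isMinimizer_diracFamily hsemi hbig hx hmem))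
      subst this
      exact ⟨hu', hv'⟩
    exact ⟨u, hcrit, fun x hx => (hall x hx).1,
      F_eq_singleton ⟨x₀, hx₀⟩ (fun x hx => (hall x hx).1) (fun x hx => (hall x hx).2)
        (h23 (h12 h))⟩
  refine ⟨?_, hmain⟩
  tfae_have 1 → 2 := h12
  tfae_have 2 → 3 := h23
  tfae_have 3 → 4 := fun h => ⟨x₀, hx₀, h x₀ hx₀⟩
  tfae_have 4 → 1 := h41
  tfae_have 1 → 5 := fun h v => by
    obtain ⟨u, -, -, hF⟩ := hmain h
    exact ⟨u v, hF v⟩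
  tfae_have 5 → 2 := fun h x hx => adelicSolutions_eq_singleton_of_F hsemi hbig h hx
  tfae_finish
end
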